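/- Let $(X_i)_{i\in\mathbb Z}$ be a strictly stationary sequence of random variables on a probability space $(\Omega,\mathcal T,\mathbb P)$ with values in a Polish space $E$, and let $\mu$ be the law of $X_0$. For $n>0$ let $$\beta(n)=\mathbb E\Bigl(\sup_{C}\bigl|\mathbb P(X_0\in C\mid\mathcal F_{-n})-\mathbb P(X_0\in C)\bigr|\Bigr),\qquad \mathcal F_{-n}=\sigma(X_k:k\le -n),$$ where the supremum is over the Borel sets $C$ of $E$ and $\mathbb P(X_0\in\cdot\mid\mathcal F_{-n})$ is a regular version of the conditional law. Assume that $\lim_{n\to\infty}\beta(n)=0$. Let $(A_k)_{k>0}$ be Borel sets of $E$ with $\sum_{k>0}\mu(A_k)=\infty$, and put $$B_k=\{X_k\in A_k\},\quad S_n=\sum_{k=1}^n\mathbf 1_{B_k},\quad E_n=\sum_{k=1}^n\mu(A_k)=\mathbb E(S_n),\quad H_n=E_n^{-1}\sum_{k=1}^n\mathbf 1_{A_k},$$ with $H_n=0$ if $E_n=0$. (i) If $\mu(\limsup_n A_n)>0$, then $(B_k)_{k>0}$ is a Borel–Cantelli sequence: $\mathbb P(\limsup_k B_k)=1$. (ii)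 If $(H_n)_{n>0}$ is uniformly integrable in $(E,\mathcal B(E),\mu)$, then $(B_k)_{k>0}$ is an $L^1$ Borel–Cantelli sequence: $\sum_{k>0}\mathbb P(B_k)=\infty$ and $\lim_{n\to\infty}\|S_n/E_n-1\|_1=0$. (iii) Let $Q_{H_n}(u)=\inf\{t\ge 0:\mu(H_n>t)\le u\}$ be the càdlàg inverse of the tail function $t\mapsto\mu(H_n>t)$, and set $Q^*(0)=0$ and $Q^*(u)=u^{-1}\sup_{n>0}\int_0^u Q_{H_n}(s)\,ds$ for $u\in(0,1]$. If $$\sum_{j>0}j^{-1}\beta(j)\,Q^*(\beta(j))<\infty,$$ then $(B_k)_{k>0}$ is a strongly Borel–Cantelli sequence: $\sum_{k>0}\mathbb P(B_k)=\infty$ and $\lim_{n\to\infty}S_n/E_n=1$ almost surely. -/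

import Mathlib

open MeasureTheory ProbabilityTheory Filter Topology
open scoped ENNReal

/-! ### Borel-Cantelli sequences

Sequences of events `(B_k)_{k>0}` are functions `B : ℕ → Set Ω`; the value `B 0` is never used. -/

/-- `hitCount B n ω = ∑_{k=1}^n 1_{B_k}(ω)`. -/
noncomputable def hitCount {Ω : Type*} (B : ℕ → Set Ω) (n : ℕ) (ω : Ω) : ℝ :=
  ∑ k ∈ Finset.Icc 1 n, (B k).indicator (fun _ => (1 : ℝ)) ω

/-- `hitMean P B n = ∑_{k=1}^n P(B_k)`, the expectation of `hitCount B n` for measurable `B_k`. -/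
noncomputable def hitMean {Ω : Type*} [MeasurableSpace Ω] (P : Measure Ω) (B : ℕ → Set Ω)
    (n : ℕ) : ℝ :=
  ∑ k ∈ Finset.Icc 1 n, P.real (B k)

/-- `∑_{k>0} P(B_k) = ∞`. -/
def DivergentMass {Ω : Type*} [MeasurableSpace Ω] (P : Measure Ω) (B : ℕ → Set Ω) : Prop :=
  ∑' k : ℕ, P (B (k + 1)) = ∞

/-- Borel-Cantelli sequence: `P(limsup_k B_k) = 1`. -/
def IsBorelCantelli {Ω : Type*} [MeasurableSpace Ω] (P : Measure Ω) (B : ℕ → Set Ω) : Prop :=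
  P (limsup B atTop) = 1

/-- `L¹` Borel-Cantelli sequence: `∑ P(B_k) = ∞` and `‖S_n / E_n - 1‖₁ → 0`. -/
def IsL1BorelCantelli {Ω : Type*} [MeasurableSpace Ω] (P : Measure Ω) (B : ℕ → Set Ω) : Prop :=
  DivergentMass P B ∧
    Tendsto (fun n : ℕ => eLpNorm (fun ω => hitCount B n ω / hitMean P B n - 1) 1 P)
      atTop (𝓝 0)

/-- Strongly Borel-Cantelli sequence: `∑ P(B_k) = ∞` and `S_n / E_n → 1` almost surely. -/
def IsStronglyBorelCantelli {Ω : Type*} [MeasurableSpace Ω] (P : Measure Ω)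
    (B : ℕ → Set Ω) : Prop :=
  DivergentMass P B ∧
    ∀ᵐ ω ∂P, Tendsto (fun n : ℕ => hitCount B n ω / hitMean P B n) atTop (𝓝 1)

/-! ### Stationarity and absolute regularity -/

/-- Strict stationarity: the law of the process `(X_i)_{i ∈ ℤ}` on `E^ℤ` is invariant under all
time shifts. -/
def StrictlyStationary {Ω E : Type*} [MeasurableSpace Ω] [MeasurableSpace E] (P : Measure Ω)
    (X : ℤ → Ω → E) : Prop :=
  ∀ m : ℤ, P.map (fun ω (i : ℤ) => X (i + m) ω) = P.map (fun ω (i : ℤ) => X i ω)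

/-- The `σ`-field `F_m = σ(X_k : k ≤ m)`. -/
@[reducible]
def pastSigma {Ω E : Type*} [mE : MeasurableSpace E] (X : ℤ → Ω → E) (m : ℤ) :
    MeasurableSpace Ω :=
  ⨆ k : ℤ, ⨆ _ : k ≤ m, mE.comap (X k)

/-- The coefficient `β(𝒜, σ(Y)) = 𝔼 (sup_{B ∈ σ(Y)} |P(B | 𝒜) - P(B)|)`, for a sub-`σ`-field `𝒜`
and a random variable `Y` with values in a standard Borel space.  The sets `B ∈ σ(Y)` are the
`{Y ∈ C}` with `C` measurable, and the regular version of `C ↦ P(Y ∈ C | 𝒜)` is the conditional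
distribution of `Y` given the identity map from `Ω` to `(Ω, 𝒜)`.  The supremum and the expectation
are taken in `[0, ∞]`; the value is at most `1`. -/
noncomputable def betaCoeff {Ω E : Type*} [mΩ : MeasurableSpace Ω] [MeasurableSpace E]
    [StandardBorelSpace E] [Nonempty E] (P : Measure Ω) [IsFiniteMeasure P]
    (𝒜 : MeasurableSpace Ω) (Y : Ω → E) : ℝ :=
  (∫⁻ ω, ⨆ (C : Set E) (_ : MeasurableSet C),
    ENNReal.ofReal
      |((@condDistrib Ω Ω E _ _ _ mΩ 𝒜 Y id P _) ω).real C - P.real (Y ⁻¹' C)| ∂P).toReal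

/-- The mixing coefficient `β_{∞,1}(n) = β(F_{-n}, σ(X_0))`. -/
noncomputable def betaMixing {Ω E : Type*} [MeasurableSpace Ω] [MeasurableSpace E]
    [StandardBorelSpace E] [Nonempty E] (P : Measure Ω) [IsFiniteMeasure P]
    (X : ℤ → Ω → E) (n : ℕ) : ℝ :=
  betaCoeff P (pastSigma X (-(n : ℤ))) (X 0)

/-! ### The functions `H_n` and the quantile function `Q*` -/

/-- `H_n = E_n⁻¹ ∑_{k=1}^n 1_{A_k}` with `E_n = ∑_{k=1}^n μ(A_k)`
(so `H_n = 0` for the indices with `E_n = 0`). -/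
noncomputable def normalizedHits {E : Type*} [MeasurableSpace E] (μ : Measure E) (A : ℕ → Set E)
    (n : ℕ) (x : E) : ℝ :=
  (hitMean μ A n)⁻¹ * hitCount A n x

/-- The cadlag inverse `Q_Z(u) = inf {t ≥ 0 : μ(Z > t) ≤ u}` of the tail function of a nonnegative
function `Z`. -/
noncomputable def tailQuantile {E : Type*} [MeasurableSpace E] (μ : Measure E) (Z : E → ℝ)
    (u : ℝ) : ℝ :=
  sInf {t : ℝ | 0 ≤ t ∧ μ.real {x | t < Z x} ≤ u}

/-- `Q*(0) = 0` and `Q*(u) = u⁻¹ sup_{n>0} ∫_0^u Q_{H_n}(s) ds` for `u ∈ (0,1]`.  The supremum is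
over a bounded set, as each integral is at most `∫ H_n dμ ≤ 1`. -/
noncomputable def quantileStar {E : Type*} [MeasurableSpace E] (μ : Measure E) (A : ℕ → Set E)
    (u : ℝ) : ℝ :=
  if u = 0 then 0
  else u⁻¹ * ⨆ n : {n : ℕ // 0 < n}, ∫ s in (0 : ℝ)..u, tailQuantile μ (normalizedHits μ A n) s

/-!
Fix a gap `p` and write `ℱ m` for the past `σ(X k : k ≤ m)`. Then `S n - E n = M + R`, where
`M = ∑ k ≤ n, (1_{B k} - ℙ(B k | ℱ (k - p)))` and `R = ∑ k ≤ n, (ℙ(B k | ℱ (k - p)) - μ (A k))`.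

* Summands of `M` at distance at least `p` are orthogonal, so `𝔼 M² ≤ 4 p E n`, whatever the
  dependence (`integral_sum_innovation_sq_le`).
* A Hahn decomposition of the joint law of the past and `X 0` against the product of its marginals
  gives a measure `ν ≤ μ` of mass at most `β p` such that
  `ℙ(G ∩ {X 0 ∈ A}) ≤ ℙ(G) μ(A) + ν(A)` for every `G` in `ℱ (-p)` (`exists_excess_measure`). By
  stationarity the same `ν` serves at all times, so `𝔼|R| ≤ 2 ∑ k ≤ n, ν (A k) = 2 E n ∫ H n ∂ν`
  (`exists_excess_measure_hitCount`).

It remains to bound `∫ H n ∂ν` uniformly in `n` for measures `ν ≤ μ` of small mass.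

* If `(H n)` is uniformly integrable, `∫ H n ∂ν ≤ C β p + ε`; choosing `ε`, then `p`, then `n`, gives
  convergence in `L¹`.
* If `μ (limsup A) > 0`, a greedy rule which drops a hit whenever the current count is too large
  compared with its mean extracts sets `A' k ⊆ A k` for which `H' n` is bounded and the masses still
  add up to `∞` (`divergentMass_greedySet`). Convergence in `L¹` for `A'` makes the number of hits
  almost surely infinite.
* In general `∫ H n ∂ν ≤ ∫ u in 0..β p, Q_{H n} u ≤ β p * Q* (β p)` by the layer cake formula
  (`hitMean_le_mul_quantileStar`). Along times at which `E n` grows geometrically, gaps `p` of order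
  `√(E n)` make both `𝔼 (M / E n)²` and `𝔼 |R| / E n` summable; for the second, each dyadic block of
  gaps contains one that does no worse than the average of the assumed series over that block
  (`exists_dyadic_summable_comp`). Monotonicity of `S n` fills the gaps between these times.
-/

/-! ### The excess measure of a coordinate over its past -/

/-- The measure `ν` is the second marginal of the positive part of the difference between the joint
law of `(Z, Y)` and the product of its marginals. Each section of the positive set of a Hahn
decomposition is a candidate in the supremum over `C`, which bounds the mass of `ν`; no
measurability of that supremum is needed. -/
theorem exists_excess_measure {Ω Ω' E : Type*} [MeasurableSpace Ω] [MeasurableSpace Ω']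
    [MeasurableSpace E] [StandardBorelSpace E] [Nonempty E]
    (P : Measure Ω) [IsProbabilityMeasure P] {Y : Ω → E} {Z : Ω → Ω'}
    (hY : Measurable Y) (hZ : Measurable Z) :
    ∃ ν : Measure E, ν ≤ P.map Y ∧
      ν Set.univ ≤ ∫⁻ ω, ⨆ (C : Set E) (_ : MeasurableSet C),
        ENNReal.ofReal |(condDistrib Y Z P (Z ω)).real C - P.real (Y ⁻¹' C)| ∂P ∧
      ∀ G A, MeasurableSet G → MeasurableSet A →
        P (Z ⁻¹' G ∩ Y ⁻¹' A) ≤ P (Z ⁻¹' G) * P (Y ⁻¹' A) + ν A := by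
  have hZY : Measurable fun ω => (Z ω, Y ω) := hZ.prodMk hY
  set π : Measure (Ω' × E) := P.map fun ω => (Z ω, Y ω) with hπ
  set π₀ : Measure (Ω' × E) := (P.map Z).prod (P.map Y) with hπ₀
  have : IsProbabilityMeasure (P.map Y) := Measure.isProbabilityMeasure_map hY.aemeasurable
  have : IsProbabilityMeasure (P.map Z) := Measure.isProbabilityMeasure_map hZ.aemeasurable
  have : IsProbabilityMeasure π := Measure.isProbabilityMeasure_map hZY.aemeasurable
  obtain ⟨W, hW, hpos, hneg⟩ := hahn_decomposition π π₀
  have hle : π₀.restrict W ≤ π.restrict W := by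
    refine Measure.le_iff.2 fun s hs => ?_
    rw [Measure.restrict_apply hs, Measure.restrict_apply hs]
    exact hpos _ (hs.inter hW) Set.inter_subset_right
  refine ⟨(π.restrict W - π₀.restrict W).map Prod.snd, ?_, ?_, ?_⟩
  · calc (π.restrict W - π₀.restrict W).map Prod.snd
        ≤ π.map Prod.snd :=
          Measure.map_mono (Measure.sub_le.trans Measure.restrict_le_self) measurable_snd
      _ = P.map Y := by rw [hπ, Measure.map_map measurable_snd hZY]; rfl
  · rw [Measure.map_apply measurable_snd MeasurableSet.univ, Set.preimage_univ,
      Measure.sub_apply MeasurableSet.univ hle, Measure.restrict_apply_univ,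
      Measure.restrict_apply_univ]
    refine tsub_le_iff_left.2 ?_
    have h1 : π W = ∫⁻ ω, condDistrib Y Z P (Z ω) (Prod.mk (Z ω) ⁻¹' W) ∂P := by
      rw [hπ, ← compProd_map_condDistrib hY.aemeasurable, Measure.compProd_apply hW,
        lintegral_map (Kernel.measurable_kernel_prodMk_left hW) hZ]
    have h0 : π₀ W = ∫⁻ ω, P.map Y (Prod.mk (Z ω) ⁻¹' W) ∂P := by
      rw [hπ₀, Measure.prod_apply hW, lintegral_map (measurable_measure_prodMk_left hW) hZ]
    rw [h1, h0]
    have hm : Measurable fun ω => P.map Y (Prod.mk (Z ω) ⁻¹' W) :=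
      (measurable_measure_prodMk_left hW).comp hZ
    rw [← lintegral_add_left hm]
    refine lintegral_mono fun ω => ?_
    have hC : MeasurableSet (Prod.mk (Z ω) ⁻¹' W) := measurable_prodMk_left hW
    refine le_trans ?_ (add_le_add le_rfl (le_iSup₂_of_le _ hC le_rfl))
    rw [Measure.map_apply hY hC, ← ofReal_measureReal (μ := P),
      ← ofReal_measureReal (μ := condDistrib Y Z P (Z ω)),
      ← ENNReal.ofReal_add measureReal_nonneg (abs_nonneg _)]
    refine ENNReal.ofReal_le_ofReal ?_
    linarith [le_abs_self ((condDistrib Y Z P (Z ω)).real (Prod.mk (Z ω) ⁻¹' W)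
      - P.real (Y ⁻¹' (Prod.mk (Z ω) ⁻¹' W)))]
  · intro G A hG hA
    have hGA : MeasurableSet (G ×ˢ A) := hG.prod hA
    have e1 : P (Z ⁻¹' G ∩ Y ⁻¹' A) = π (G ×ˢ A) := by
      rw [hπ, Measure.map_apply hZY hGA]; rfl
    have e0 : P (Z ⁻¹' G) * P (Y ⁻¹' A) = π₀ (G ×ˢ A) := by
      rw [hπ₀, Measure.prod_prod, Measure.map_apply hZ hG, Measure.map_apply hY hA]
    have e2 : π (G ×ˢ A ∩ W) ≤
        π₀ (G ×ˢ A ∩ W) + ((π.restrict W - π₀.restrict W).map Prod.snd) A := by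
      rw [Measure.map_apply measurable_snd hA]
      refine le_trans ?_ (add_le_add le_rfl (measure_mono (s := G ×ˢ A) fun x hx => hx.2))
      rw [Measure.sub_apply hGA hle, Measure.restrict_apply hGA, Measure.restrict_apply hGA]
      exact le_add_tsub
    rw [e1, e0, ← measure_inter_add_sdiff (μ := π) _ hW, ← measure_inter_add_sdiff (μ := π₀) _ hW,
      add_right_comm]
    exact add_le_add e2 (hneg _ (hGA.diff hW) fun x hx => hx.2)

theorem exists_excess_measure_betaCoeff {Ω E : Type*} {𝒜 : MeasurableSpace Ω}
    [mΩ : MeasurableSpace Ω] [MeasurableSpace E] [StandardBorelSpace E] [Nonempty E]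
    (P : Measure Ω) [IsProbabilityMeasure P] (h𝒜 : 𝒜 ≤ mΩ)
    {Y : Ω → E} (hY : Measurable Y) :
    ∃ ν : Measure E, ν ≤ P.map Y ∧ ν Set.univ ≤ ENNReal.ofReal (betaCoeff P 𝒜 Y) ∧
      ∀ G A, MeasurableSet[𝒜] G → MeasurableSet A →
        P (G ∩ Y ⁻¹' A) ≤ P G * P (Y ⁻¹' A) + ν A := by
  obtain ⟨ν, h1, h2, h3⟩ := @exists_excess_measure Ω Ω E mΩ 𝒜 _ _ _ P _ Y id hY
    (measurable_id'' h𝒜)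
  refine ⟨ν, h1, ?_, h3⟩
  rw [betaCoeff, ENNReal.ofReal_toReal]
  · exact h2
  · refine ((lintegral_mono (g := fun _ => ENNReal.ofReal 1) fun ω => ?_).trans_lt ?_).ne
    · refine iSup₂_le fun C _ => ENNReal.ofReal_le_ofReal ?_
      exact abs_sub_le_of_nonneg_of_le measureReal_nonneg measureReal_le_one measureReal_nonneg
        measureReal_le_one
    · simp

theorem pastSigma_le {Ω E : Type*} [mΩ : MeasurableSpace Ω] [MeasurableSpace E] {X : ℤ → Ω → E}
    (hX : ∀ i, Measurable (X i)) (m : ℤ) : pastSigma X m ≤ mΩ :=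
  iSup₂_le fun k _ => (hX k).comap_le

theorem pastSigma_mono {Ω E : Type*} [MeasurableSpace E] (X : ℤ → Ω → E) :
    Monotone (pastSigma X) := fun _ _ h =>
  iSup₂_le fun k hk => le_iSup₂_of_le k (hk.trans h) le_rfl

/-- Conditioning events and a single coordinate can be shifted together to the time origin. -/
theorem StrictlyStationary.exists_shift_to_origin {Ω E : Type*} [MeasurableSpace Ω]
    [MeasurableSpace E] {P : Measure Ω} {X : ℤ → Ω → E} (hX : ∀ i, Measurable (X i))
    (hstat : StrictlyStationary P X) (k m : ℤ) {G : Set Ω} (hG : MeasurableSet[pastSigma X m] G) :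
    ∃ G' : Set Ω, MeasurableSet[pastSigma X (m - k)] G' ∧ P G' = P G ∧
      ∀ A, MeasurableSet A → P (G ∩ X k ⁻¹' A) = P (G' ∩ X 0 ⁻¹' A) := by
  have hcomap : ∀ l : ℤ, MeasurableSpace.comap (fun ω (i : ℤ) => X (i + l) ω)
      (pastSigma (fun (i : ℤ) (x : ℤ → E) => x i) m) = pastSigma (fun i => X (i + l)) m := by
    intro l
    simp only [pastSigma, MeasurableSpace.comap_iSup, MeasurableSpace.comap_comp]
    rfl
  have h0 : pastSigma X m = MeasurableSpace.comap (fun ω (i : ℤ) => X (i + 0) ω)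
      (pastSigma (fun (i : ℤ) (x : ℤ → E) => x i) m) := by
    rw [hcomap]; simp
  rw [h0] at hG
  obtain ⟨Γ, hΓ, rfl⟩ := hG
  have hΓ' : MeasurableSet Γ := pastSigma_le (fun i => measurable_pi_apply i) m _ hΓ
  have hpath : ∀ l : ℤ, Measurable fun ω (i : ℤ) => X (i + l) ω := fun l =>
    measurable_pi_lambda _ fun i => hX (i + l)
  have key : ∀ T : Set (ℤ → E), MeasurableSet T →
      P ((fun ω (i : ℤ) => X (i + 0) ω) ⁻¹' T) = P ((fun ω (i : ℤ) => X (i + -k) ω) ⁻¹' T) := by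
    intro T hT
    rw [← Measure.map_apply (hpath 0) hT, ← Measure.map_apply (hpath (-k)) hT, hstat 0,
      hstat (-k)]
  refine ⟨(fun ω (i : ℤ) => X (i + -k) ω) ⁻¹' Γ, ?_, (key Γ hΓ').symm, fun A hA => ?_⟩
  · have hle : pastSigma (fun i => X (i + -k)) m ≤ pastSigma X (m - k) :=
      iSup₂_le fun i hi => le_iSup₂_of_le (i + -k) (by lia) le_rfl
    refine hle _ ?_
    rw [← hcomap]
    exact ⟨Γ, hΓ, rfl⟩
  · have := key (Γ ∩ (fun x : ℤ → E => x k) ⁻¹' A) (hΓ'.inter (measurable_pi_apply k hA))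
    simp only [add_zero, Set.preimage_inter, Set.preimage_preimage, add_neg_cancel] at this ⊢
    exact this

theorem StrictlyStationary.map_eq {Ω E : Type*} [MeasurableSpace Ω]
    [MeasurableSpace E] {P : Measure Ω} {X : ℤ → Ω → E} (hX : ∀ i, Measurable (X i))
    (hstat : StrictlyStationary P X) (k : ℤ) : P.map (X k) = P.map (X 0) := by
  have h1 := congrArg (Measure.map fun x : ℤ → E => x 0) (hstat k)
  rw [Measure.map_map (measurable_pi_apply 0) (measurable_pi_lambda _ fun i => hX (i + k)),
    Measure.map_map (measurable_pi_apply 0) (measurable_pi_lambda _ hX)] at h1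
  simpa [Function.comp_def] using h1

theorem exists_excess_measure_betaMixing {Ω E : Type*} [MeasurableSpace Ω]
    [MeasurableSpace E] [StandardBorelSpace E] [Nonempty E]
    (P : Measure Ω) [IsProbabilityMeasure P] {X : ℤ → Ω → E} (hX : ∀ i, Measurable (X i))
    (hstat : StrictlyStationary P X) (p : ℕ) :
    ∃ ν : Measure E, ν ≤ P.map (X 0) ∧ ν Set.univ ≤ ENNReal.ofReal (betaMixing P X p) ∧
      ∀ (k : ℤ) (G : Set Ω) (A : Set E), MeasurableSet[pastSigma X (k - p)] G → MeasurableSet A →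
        P (G ∩ X k ⁻¹' A) ≤ P G * P (X k ⁻¹' A) + ν A := by
  obtain ⟨ν, h1, h2, h3⟩ := exists_excess_measure_betaCoeff P (pastSigma_le hX (-(p : ℤ))) (hX 0)
  refine ⟨ν, h1, h2, fun k G A hG hA => ?_⟩
  obtain ⟨G', hG', hPG, h⟩ := hstat.exists_shift_to_origin hX k _ hG
  have hk : P (X k ⁻¹' A) = P (X 0 ⁻¹' A) := by
    rw [← Measure.map_apply (hX k) hA, hstat.map_eq hX k, Measure.map_apply (hX 0) hA]
  rw [h A hA, ← hPG, hk]
  refine h3 G' A ?_ hA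
  convert hG' using 2
  ring

/-! ### Innovations and the decomposition of the hit count -/

/-- It suffices to control `ℙ(G ∩ B) - ℙ(G) ℙ(B)` for the single event `G = {ℙ(B | m) > ℙ(B)}`,
since `ℙ(B | m) - ℙ(B)` is centered. -/
theorem integral_abs_condExp_indicator_sub_le {Ω : Type*} {m : MeasurableSpace Ω}
    [mΩ : MeasurableSpace Ω] (P : Measure Ω) [IsProbabilityMeasure P] (hm : m ≤ mΩ)
    {B : Set Ω} (hB : MeasurableSet B) {c : ℝ}
    (h : ∀ G, MeasurableSet[m] G → P.real (G ∩ B) ≤ P.real G * P.real B + c) :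
    ∫ ω, |(P[B.indicator (fun _ => (1 : ℝ)) | m]) ω - P.real B| ∂P ≤ 2 * c := by
  set f : Ω → ℝ := B.indicator fun _ => (1 : ℝ) with hf
  have hfi : Integrable f P := (integrable_const 1).indicator hB
  have hgi : Integrable (fun ω => (P[f | m]) ω - P.real B) P :=
    integrable_condExp.sub (integrable_const _)
  have hfint : ∫ ω, f ω ∂P = P.real B := by rw [hf, integral_indicator_const _ hB, smul_eq_mul, mul_one]
  have hg0 : ∫ ω, ((P[f | m]) ω - P.real B) ∂P = 0 := by
    rw [integral_sub integrable_condExp (integrable_const _), integral_condExp hm, hfint]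
    simp
  have hG : MeasurableSet[m] {ω | P.real B < (P[f | m]) ω} :=
    stronglyMeasurable_condExp.measurable measurableSet_Ioi
  set G := {ω | P.real B < (P[f | m]) ω} with hGdef
  have habs : ∀ ω, |(P[f | m]) ω - P.real B| =
      2 * G.indicator (fun ω => (P[f | m]) ω - P.real B) ω - ((P[f | m]) ω - P.real B) := by
    intro ω
    by_cases hω : ω ∈ G
    · rw [Set.indicator_of_mem hω, abs_of_nonneg (sub_nonneg.2 (le_of_lt hω))]; ring
    · rw [Set.indicator_of_notMem hω, abs_of_nonpos (sub_nonpos.2 (not_lt.1 hω))]; ring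
  have hGm := hm _ hG
  simp_rw [habs]
  rw [integral_sub ((hgi.indicator hGm).const_mul 2) hgi, hg0, sub_zero, integral_const_mul,
    integral_indicator hGm, integral_sub integrable_condExp.integrableOn (integrable_const _),
    setIntegral_condExp hm hfi hG]
  have h1 : ∫ ω in G, f ω ∂P = P.real (G ∩ B) := by
    rw [hf, integral_indicator_const _ hB, smul_eq_mul, mul_one, measureReal_restrict_apply hB, Set.inter_comm]
  rw [h1, setIntegral_const, smul_eq_mul]
  linarith [h G hG]

/-- The indicator of `B` minus its conditional probability given `m`. -/
noncomputable def indicatorInnovation {Ω : Type*} [MeasurableSpace Ω] (P : Measure Ω)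
    (m : MeasurableSpace Ω) (B : Set Ω) (ω : Ω) : ℝ :=
  B.indicator (fun _ => (1 : ℝ)) ω - (P[B.indicator (fun _ => (1 : ℝ)) | m]) ω

theorem condExp_indicator_mem_Icc {Ω : Type*} {m : MeasurableSpace Ω}
    [mΩ : MeasurableSpace Ω] (P : Measure Ω) [IsProbabilityMeasure P] (hm : m ≤ mΩ)
    {B : Set Ω} (hB : MeasurableSet B) :
    ∀ᵐ ω ∂P, (P[B.indicator (fun _ => (1 : ℝ)) | m]) ω ∈ Set.Icc (0 : ℝ) 1 := by
  have h0 : 0 ≤ᵐ[P] P[B.indicator (fun _ => (1 : ℝ)) | m] :=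
    condExp_nonneg (Eventually.of_forall fun ω => Set.indicator_nonneg (fun _ _ => zero_le_one) ω)
  have h1 : P[B.indicator (fun _ => (1 : ℝ)) | m] ≤ᵐ[P] P[(fun _ => (1 : ℝ)) | m] :=
    condExp_mono ((integrable_const 1).indicator hB) (integrable_const 1)
      (Eventually.of_forall fun ω => Set.indicator_le_self' (fun _ _ => zero_le_one) ω)
  rw [condExp_const hm] at h1
  filter_upwards [h0, h1] with ω a b using ⟨a, b⟩

section Innovation

variable {Ω : Type*} {m : MeasurableSpace Ω} [mΩ : MeasurableSpace Ω] {P : Measure Ω}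
  [IsProbabilityMeasure P] {B : Set Ω}

theorem integrable_indicatorInnovation (hB : MeasurableSet B) :
    Integrable (indicatorInnovation P m B) P :=
  ((integrable_const 1).indicator hB).sub integrable_condExp

theorem abs_indicatorInnovation_le (hm : m ≤ mΩ) (hB : MeasurableSet B) :
    ∀ᵐ ω ∂P, |indicatorInnovation P m B ω| ≤ 1 := by
  filter_upwards [condExp_indicator_mem_Icc P hm hB] with ω hω
  rw [indicatorInnovation]
  refine abs_sub_le_of_nonneg_of_le (Set.indicator_nonneg (fun _ _ => zero_le_one) ω)
    (Set.indicator_le_self' (fun _ _ => zero_le_one) ω) hω.1 hω.2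

theorem integral_abs_indicatorInnovation_le (hm : m ≤ mΩ) (hB : MeasurableSet B) :
    ∫ ω, |indicatorInnovation P m B ω| ∂P ≤ 2 * P.real B := by
  have hi : Integrable (B.indicator fun _ => (1 : ℝ)) P := (integrable_const 1).indicator hB
  have h : ∫ ω, |indicatorInnovation P m B ω| ∂P ≤
      ∫ ω, (B.indicator (fun _ => (1 : ℝ)) ω + (P[B.indicator (fun _ => (1 : ℝ)) | m]) ω) ∂P := by
    refine integral_mono_ae (integrable_indicatorInnovation hB).abs
      (hi.add integrable_condExp) ?_
    filter_upwards [condExp_indicator_mem_Icc P hm hB] with ω hω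
    rw [indicatorInnovation]
    refine (abs_sub _ _).trans ?_
    rw [abs_of_nonneg (Set.indicator_nonneg (fun _ _ => zero_le_one) ω), abs_of_nonneg hω.1]
  refine h.trans_eq ?_
  rw [integral_add hi integrable_condExp, integral_condExp hm, integral_indicator_const _ hB, smul_eq_mul, mul_one]
  ring

theorem integral_mul_indicatorInnovation_eq_zero (hm : m ≤ mΩ) (hB : MeasurableSet B)
    {g : Ω → ℝ} (hg : StronglyMeasurable[m] g) {C : ℝ} (hgC : ∀ᵐ ω ∂P, |g ω| ≤ C) :
    ∫ ω, g ω * indicatorInnovation P m B ω ∂P = 0 := by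
  set f : Ω → ℝ := B.indicator fun _ => (1 : ℝ) with hf
  have hi : Integrable f P := (integrable_const 1).indicator hB
  have hgm : AEStronglyMeasurable g P := (hg.mono hm).aestronglyMeasurable
  have h1 : Integrable (g * f) P := hi.bdd_mul hgm hgC
  have h2 : Integrable (g * P[f | m]) P := integrable_condExp.bdd_mul hgm hgC
  have h3 := condExp_mul_of_stronglyMeasurable_left hg h1 hi
  have h4 : ∫ ω, (g * f) ω ∂P = ∫ ω, (g * P[f | m]) ω ∂P := by
    rw [← integral_condExp hm]; exact integral_congr_ae h3
  have h5 : ∀ ω, g ω * indicatorInnovation P m B ω = (g * f) ω - (g * P[f | m]) ω := fun ω => by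
    simp only [indicatorInnovation, Pi.mul_apply]; ring
  simp_rw [h5]
  rw [integral_sub h1 h2, h4, sub_self]

end Innovation

section Decomposition

variable {Ω : Type*} [mΩ : MeasurableSpace Ω] {P : Measure Ω} [IsProbabilityMeasure P]
  {ℱ : ℤ → MeasurableSpace Ω} {B : ℕ → Set Ω}

theorem integral_mul_innovation_eq_zero_of_add_le (hℱ : Monotone ℱ) (hle : ∀ i, ℱ i ≤ mΩ)
    (hB : ∀ k : ℕ, 0 < k → MeasurableSet[ℱ k] (B k)) {p k l : ℕ} (hk : 0 < k)
    (hkl : k + p ≤ l) :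
    ∫ ω, indicatorInnovation P (ℱ (k - p)) (B k) ω * indicatorInnovation P (ℱ (l - p)) (B l) ω ∂P
      = 0 := by
  have hl : 0 < l := by lia
  refine integral_mul_indicatorInnovation_eq_zero (hle _) (hle _ _ (hB l hl)) ?_
    (abs_indicatorInnovation_le (hle _) (hle _ _ (hB k hk)))
  have h1 : ℱ k ≤ ℱ (l - p) := hℱ (by lia)
  refine StronglyMeasurable.sub ?_ ?_
  · exact stronglyMeasurable_const.indicator (h1 _ (hB k hk))
  · exact stronglyMeasurable_condExp.mono (hℱ (by lia))

/-- Innovations at distance at least `p` are orthogonal, and each of the remaining `O(p)` inner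
products in a row is at most `2 P(B k)`. -/
theorem integral_sum_innovation_sq_le (hℱ : Monotone ℱ) (hle : ∀ i, ℱ i ≤ mΩ)
    (hB : ∀ k : ℕ, 0 < k → MeasurableSet[ℱ k] (B k)) (p n : ℕ) :
    Integrable (fun ω => (∑ k ∈ Finset.Icc 1 n, indicatorInnovation P (ℱ (k - p)) (B k) ω) ^ 2) P ∧
    ∫ ω, (∑ k ∈ Finset.Icc 1 n, indicatorInnovation P (ℱ (k - p)) (B k) ω) ^ 2 ∂P ≤
      4 * p * hitMean P B n := by
  have hBm : ∀ k ∈ Finset.Icc 1 n, MeasurableSet (B k) := fun k hk =>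
    hle _ _ (hB k (Finset.mem_Icc.1 hk).1)
  have hint : ∀ k ∈ Finset.Icc 1 n, ∀ l ∈ Finset.Icc 1 n, Integrable (fun ω =>
      indicatorInnovation P (ℱ (k - p)) (B k) ω * indicatorInnovation P (ℱ (l - p)) (B l) ω) P :=
    fun k hk l hl => (integrable_indicatorInnovation (hBm l hl)).bdd_mul
      (integrable_indicatorInnovation (hBm k hk)).aestronglyMeasurable
      (abs_indicatorInnovation_le (hle _) (hBm k hk))
  have hterm : ∀ k ∈ Finset.Icc 1 n, ∀ l ∈ Finset.Icc 1 n, ∫ ω,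
      indicatorInnovation P (ℱ (k - p)) (B k) ω * indicatorInnovation P (ℱ (l - p)) (B l) ω ∂P ≤
      if l ∈ Finset.Ico (k + 1 - p) (k + p) then 2 * P.real (B k) else 0 := by
    intro k hk l hl
    split_ifs with h
    · refine (integral_mono_ae (hint k hk l hl)
        (integrable_indicatorInnovation (m := ℱ (k - p)) (hBm k hk)).abs ?_).trans
        (integral_abs_indicatorInnovation_le (hle _) (hBm k hk))
      filter_upwards [abs_indicatorInnovation_le (P := P) (hle (l - p)) (hBm l hl)] with ω hω
      refine (le_abs_self _).trans ?_
      rw [abs_mul]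
      exact mul_le_of_le_one_right (abs_nonneg _) hω
    · rw [Finset.mem_Ico, not_and_or, not_le, not_lt] at h
      rw [Finset.mem_Icc] at hk hl
      rcases h with h | h
      · simp_rw [mul_comm (indicatorInnovation P (ℱ (k - p)) (B k) _)]
        exact (integral_mul_innovation_eq_zero_of_add_le hℱ hle hB (by lia) (by lia)).le
      · exact (integral_mul_innovation_eq_zero_of_add_le hℱ hle hB (by lia) h).le
  simp_rw [sq, Finset.sum_mul_sum]
  refine ⟨integrable_finsetSum _ fun k hk => integrable_finsetSum _ fun l hl => hint k hk l hl, ?_⟩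
  rw [integral_finsetSum _ fun k hk => integrable_finsetSum _ fun l hl => hint k hk l hl, hitMean,
    Finset.mul_sum]
  refine Finset.sum_le_sum fun k hk => ?_
  rw [integral_finsetSum _ fun l hl => hint k hk l hl]
  refine (Finset.sum_le_sum fun l hl => hterm k hk l hl).trans ?_
  rw [← Finset.sum_filter, Finset.sum_const, nsmul_eq_mul]
  have hcard : ((Finset.Icc 1 n).filter (· ∈ Finset.Ico (k + 1 - p) (k + p))).card ≤ 2 * p := by
    calc _ ≤ (Finset.Ico (k + 1 - p) (k + p)).card :=
          Finset.card_le_card fun l hl => (Finset.mem_filter.1 hl).2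
      _ ≤ 2 * p := by rw [Nat.card_Ico]; lia
  have hcard' : (((Finset.Icc 1 n).filter (· ∈ Finset.Ico (k + 1 - p) (k + p))).card : ℝ) ≤ 2 * p :=
    by exact_mod_cast hcard
  nlinarith [mul_le_mul_of_nonneg_right hcard' (measureReal_nonneg (μ := P) (s := B k))]

/-- For every gap `p`, the centered count splits into a part of second moment `O(p E_n)` and a part
controlled in `L¹` by the bounds `c k` on the dependence between `B k` and the past up to `k - p`. -/
theorem exists_hitCount_decomposition (hℱ : Monotone ℱ) (hle : ∀ i, ℱ i ≤ mΩ)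
    (hB : ∀ k : ℕ, 0 < k → MeasurableSet[ℱ k] (B k)) (p : ℕ) {c : ℕ → ℝ}
    (hc : ∀ k : ℕ, 0 < k → ∀ G, MeasurableSet[ℱ (k - p)] G →
      P.real (G ∩ B k) ≤ P.real G * P.real (B k) + c k) (n : ℕ) :
    ∃ M R : Ω → ℝ, (∀ ω, hitCount B n ω - hitMean P B n = M ω + R ω) ∧
      Integrable (fun ω => M ω ^ 2) P ∧ Integrable R P ∧
      ∫ ω, M ω ^ 2 ∂P ≤ 4 * p * hitMean P B n ∧
      ∫ ω, |R ω| ∂P ≤ 2 * ∑ k ∈ Finset.Icc 1 n, c k := by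
  obtain ⟨h1, h2⟩ := integral_sum_innovation_sq_le (P := P) hℱ hle hB p n
  have hi : ∀ k, Integrable (fun ω =>
      (P[(B k).indicator (fun _ => (1 : ℝ)) | ℱ (k - p)]) ω - P.real (B k)) P := fun k =>
    integrable_condExp.sub (integrable_const _)
  refine ⟨_, fun ω => ∑ k ∈ Finset.Icc 1 n,
    ((P[(B k).indicator (fun _ => (1 : ℝ)) | ℱ (k - p)]) ω - P.real (B k)), fun ω => ?_, h1,
    integrable_finsetSum _ fun k _ => hi k, h2, ?_⟩
  · rw [← Finset.sum_add_distrib, hitCount, hitMean, ← Finset.sum_sub_distrib]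
    exact Finset.sum_congr rfl fun k _ => by rw [indicatorInnovation]; ring
  · calc _ ≤ ∫ ω, ∑ k ∈ Finset.Icc 1 n,
          |(P[(B k).indicator (fun _ => (1 : ℝ)) | ℱ (k - p)]) ω - P.real (B k)| ∂P :=
          integral_mono (integrable_finsetSum _ fun k _ => hi k).abs
            (integrable_finsetSum _ fun k _ => (hi k).abs) fun ω => Finset.abs_sum_le_sum_abs _ _
      _ ≤ _ := by
          rw [integral_finsetSum _ fun k _ => (hi k).abs, Finset.mul_sum]
          refine Finset.sum_le_sum fun k hk => ?_
          have hk0 := (Finset.mem_Icc.1 hk).1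
          exact integral_abs_condExp_indicator_sub_le P (hle _) (hle _ _ (hB k hk0)) (hc k hk0)

end Decomposition

/-! ### Hit counts along a stationary sequence -/

section Hits

variable {E : Type*} (A : ℕ → Set E)

theorem hitCount_nonneg (n : ℕ) (x : E) : 0 ≤ hitCount A n x :=
  Finset.sum_nonneg fun _ _ => Set.indicator_nonneg (fun _ _ => zero_le_one) x

theorem hitCount_le (n : ℕ) (x : E) : hitCount A n x ≤ n := by
  refine (Finset.sum_le_card_nsmul _ _ 1 fun k _ =>
    Set.indicator_le_self' (fun _ _ => zero_le_one) x).trans ?_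
  simp

theorem hitCount_succ (n : ℕ) (x : E) :
    hitCount A (n + 1) x = hitCount A n x + (A (n + 1)).indicator (fun _ => (1 : ℝ)) x :=
  Finset.sum_Icc_succ_top (by lia) _

theorem hitCount_mono (x : E) : Monotone fun n => hitCount A n x :=
  monotone_nat_of_le_succ fun n => by
    rw [hitCount_succ]
    exact le_add_of_nonneg_right (Set.indicator_nonneg (fun _ _ => zero_le_one) x)

end Hits

section HitMean

variable {E : Type*} [MeasurableSpace E] {μ : Measure E} {A : ℕ → Set E}

theorem measurable_hitCount (hA : ∀ k, 0 < k → MeasurableSet (A k)) (n : ℕ) :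
    Measurable (hitCount A n) :=
  Finset.measurable_sum _ fun k hk =>
    measurable_const.indicator (hA k (Finset.mem_Icc.1 hk).1)

theorem hitMean_nonneg (n : ℕ) : 0 ≤ hitMean μ A n :=
  Finset.sum_nonneg fun _ _ => measureReal_nonneg

theorem hitMean_succ (n : ℕ) : hitMean μ A (n + 1) = hitMean μ A n + μ.real (A (n + 1)) :=
  Finset.sum_Icc_succ_top (by lia) _

theorem hitMean_mono : Monotone (hitMean μ A) :=
  monotone_nat_of_le_succ fun n => by
    rw [hitMean_succ]
    exact le_add_of_nonneg_right measureReal_nonneg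

theorem hitMean_eq_sum_range (n : ℕ) :
    hitMean μ A n = ∑ k ∈ Finset.range n, μ.real (A (k + 1)) := by
  induction n with
  | zero => simp [hitMean]
  | succ n ih => rw [hitMean_succ, ih, Finset.sum_range_succ]

variable [IsFiniteMeasure μ]

theorem integrable_hitCount (hA : ∀ k, 0 < k → MeasurableSet (A k)) (n : ℕ) :
    Integrable (hitCount A n) μ :=
  integrable_finsetSum _ fun k hk =>
    (integrable_const 1).indicator (hA k (Finset.mem_Icc.1 hk).1)

theorem integral_hitCount (hA : ∀ k, 0 < k → MeasurableSet (A k)) (n : ℕ) :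
    ∫ x, hitCount A n x ∂μ = hitMean μ A n := by
  simp only [hitCount, hitMean]
  rw [integral_finsetSum _ fun k hk =>
    (integrable_const 1).indicator (hA k (Finset.mem_Icc.1 hk).1)]
  refine Finset.sum_congr rfl fun k hk => ?_
  rw [integral_indicator_const _ (hA k (Finset.mem_Icc.1 hk).1), smul_eq_mul, mul_one]

theorem hitMean_mono_measure {ν : Measure E} (hν : ν ≤ μ) (n : ℕ) :
    hitMean ν A n ≤ hitMean μ A n :=
  Finset.sum_le_sum fun k _ => ENNReal.toReal_mono (measure_ne_top μ _) (hν (A k))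

theorem divergentMass_iff_tendsto_hitMean :
    DivergentMass μ A ↔ Tendsto (hitMean μ A) atTop atTop := by
  have h1 : hitMean μ A = fun n => ∑ k ∈ Finset.range n, μ.real (A (k + 1)) :=
    funext hitMean_eq_sum_range
  rw [h1, ← not_summable_iff_tendsto_nat_atTop_of_nonneg fun _ => measureReal_nonneg,
    DivergentMass, ← not_iff_not, not_not]
  constructor
  · intro h
    exact ENNReal.summable_toReal h
  · intro h
    have : ∀ k, μ (A (k + 1)) = ENNReal.ofReal (μ.real (A (k + 1))) := fun k =>
      (ofReal_measureReal).symm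
    simp_rw [this]
    exact h.tsum_ofReal_ne_top

end HitMean

/-- An event sequence which is `L¹` Borel-Cantelli is Borel-Cantelli: along a subsequence
`S_n / E_n → 1` almost surely, so that `S_n` is unbounded. -/
theorem IsL1BorelCantelli.isBorelCantelli {Ω : Type*} [MeasurableSpace Ω] {P : Measure Ω}
    [IsProbabilityMeasure P] {B : ℕ → Set Ω} (hB : ∀ k, 0 < k → MeasurableSet (B k))
    (h : IsL1BorelCantelli P B) : IsBorelCantelli P B := by
  have hE := divergentMass_iff_tendsto_hitMean.1 h.1
  have hm : TendstoInMeasure P (fun n ω => hitCount B n ω / hitMean P B n - 1) atTop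
      (fun _ => (0 : ℝ)) := by
    refine tendstoInMeasure_of_tendsto_eLpNorm (p := 1) one_ne_zero (fun n => ?_)
      aestronglyMeasurable_const ?_
    · exact (((measurable_hitCount hB n).div_const _).sub_const 1).aestronglyMeasurable
    · refine h.2.congr fun n => ?_
      congr 1
      ext ω
      simp
  obtain ⟨ns, hns, hae⟩ := hm.exists_seq_tendsto_ae
  have hall : ∀ᵐ ω ∂P, ω ∈ limsup B atTop := by
    filter_upwards [hae] with ω hω
    have h1 : Tendsto (fun i => hitCount B (ns i) ω / hitMean P B (ns i)) atTop (𝓝 1) := by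
      simpa using hω.add_const 1
    have hEn : Tendsto (fun i => hitMean P B (ns i)) atTop atTop := hE.comp hns.tendsto_atTop
    have h2 : Tendsto (fun i => hitCount B (ns i) ω) atTop atTop := by
      refine (h1.pos_mul_atTop one_pos hEn).congr' ?_
      filter_upwards [hEn.eventually_gt_atTop 0] with i hi
      exact div_mul_cancel₀ _ hi.ne'
    rw [Filter.mem_limsup_iff_frequently_mem]
    by_contra hcon
    rw [not_frequently, eventually_atTop] at hcon
    obtain ⟨N, hN⟩ := hcon
    have hbd : ∀ n, hitCount B n ω ≤ hitCount B N ω := by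
      intro n
      rcases le_total n N with hn | hn
      · exact hitCount_mono B ω hn
      · induction n, hn using Nat.le_induction with
        | base => exact le_rfl
        | succ n hn ih =>
          rw [hitCount_succ, Set.indicator_of_notMem (hN _ (by lia)), add_zero]
          exact ih
    obtain ⟨i, hi⟩ := (h2.eventually_gt_atTop (hitCount B N ω)).exists
    exact absurd (hbd _) (not_le.2 hi)
  have huniv : (limsup B atTop : Set Ω) =ᵐ[P] Set.univ := eventuallyEq_univ.2 hall
  rw [IsBorelCantelli, measure_congr huniv, measure_univ]

/-- The decomposition `S_n - E_n = M_n + R_n` behind all three claims. The measure `ν`, which depends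
on the gap `p` only, is dominated by the law of `X_0` and has mass at most `β(p)`. -/
theorem exists_excess_measure_hitCount {Ω E : Type*} [MeasurableSpace Ω]
    [MeasurableSpace E] [StandardBorelSpace E] [Nonempty E]
    (P : Measure Ω) [IsProbabilityMeasure P] {X : ℤ → Ω → E} (hX : ∀ i, Measurable (X i))
    (hstat : StrictlyStationary P X) (p : ℕ) :
    ∃ ν : Measure E, ν ≤ P.map (X 0) ∧ ν Set.univ ≤ ENNReal.ofReal (betaMixing P X p) ∧
      ∀ A : ℕ → Set E, (∀ k, 0 < k → MeasurableSet (A k)) → ∀ n : ℕ,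
      ∃ M R : Ω → ℝ, (∀ ω, hitCount (fun k => X k ⁻¹' A k) n ω - hitMean (P.map (X 0)) A n
          = M ω + R ω) ∧
        Integrable (fun ω => M ω ^ 2) P ∧ Integrable R P ∧
        ∫ ω, M ω ^ 2 ∂P ≤ 4 * p * hitMean (P.map (X 0)) A n ∧
        ∫ ω, |R ω| ∂P ≤ 2 * hitMean ν A n := by
  obtain ⟨ν, h1, h2, h3⟩ := exists_excess_measure_betaMixing P hX hstat p
  refine ⟨ν, h1, h2, fun A hA n => ?_⟩
  have hmean : hitMean (P.map (X 0)) A n = hitMean P (fun k => X k ⁻¹' A k) n := by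
    refine Finset.sum_congr rfl fun k hk => ?_
    rw [← hstat.map_eq hX k, map_measureReal_apply (hX k) (hA k (Finset.mem_Icc.1 hk).1)]
  rw [hmean]
  have hfin : IsFiniteMeasure ν :=
    ⟨h2.trans_lt ENNReal.ofReal_lt_top⟩
  refine exists_hitCount_decomposition (pastSigma_mono X) (pastSigma_le hX)
    (fun k hk => ?_) p (c := fun k => ν.real (A k)) (fun k hk G hG => ?_) n
  · exact (le_iSup₂_of_le (f := fun (i : ℤ) (_ : i ≤ k) => MeasurableSpace.comap (X i) _)
      (k : ℤ) le_rfl le_rfl) _ ⟨A k, hA k hk, rfl⟩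
  · have h := ENNReal.toReal_mono (by finiteness) (h3 k G (A k) hG (hA k hk))
    rwa [ENNReal.toReal_add (by finiteness) (by finiteness), ENNReal.toReal_mul] at h

theorem divergentMass_preimage {Ω E : Type*} [MeasurableSpace Ω] [MeasurableSpace E]
    {P : Measure Ω} {X : ℤ → Ω → E} (hX : ∀ i, Measurable (X i))
    (hstat : StrictlyStationary P X) {A : ℕ → Set E} (hA : ∀ k, 0 < k → MeasurableSet (A k)) :
    DivergentMass P (fun k => X k ⁻¹' A k) ↔ DivergentMass (P.map (X 0)) A := by
  have : ∀ k : ℕ, P (X (k + 1 : ℕ) ⁻¹' A (k + 1)) = P.map (X 0) (A (k + 1)) := fun k => by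
    rw [← hstat.map_eq hX (k + 1 : ℕ), Measure.map_apply (hX _) (hA _ k.succ_pos)]
  simp only [DivergentMass, this]

/-- The `L¹` criterion, with uniform integrability replaced by the domination it provides for
measures below `μ`. -/
theorem isL1BorelCantelli_of_dominated {Ω E : Type*} [MeasurableSpace Ω]
    [MeasurableSpace E] [StandardBorelSpace E] [Nonempty E]
    (P : Measure Ω) [IsProbabilityMeasure P] {X : ℤ → Ω → E} (hX : ∀ i, Measurable (X i))
    (hstat : StrictlyStationary P X)
    (hβ : Tendsto (fun n : ℕ => betaMixing P X n) atTop (𝓝 0))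
    {A : ℕ → Set E} (hA : ∀ k, 0 < k → MeasurableSet (A k))
    (hdiv : DivergentMass (P.map (X 0)) A)
    (hdom : ∀ ε > 0, ∃ C : ℝ, ∀ᶠ n in atTop, ∀ ν ≤ P.map (X 0),
      hitMean ν A n ≤ (C * ν.real Set.univ + ε) * hitMean (P.map (X 0)) A n) :
    IsL1BorelCantelli P fun k => X k ⁻¹' A k := by
  have : IsProbabilityMeasure (P.map (X 0)) := Measure.isProbabilityMeasure_map (hX 0).aemeasurable
  refine ⟨(divergentMass_preimage hX hstat hA).2 hdiv, ?_⟩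
  have hE := divergentMass_iff_tendsto_hitMean.1 hdiv
  have hB : ∀ k : ℕ, 0 < k → MeasurableSet (X k ⁻¹' A k) := fun k hk => hX k (hA k hk)
  have hmean : ∀ n, hitMean P (fun k => X k ⁻¹' A k) n = hitMean (P.map (X 0)) A n := fun n =>
    Finset.sum_congr rfl fun k hk => by
      rw [← hstat.map_eq hX k, map_measureReal_apply (hX k) (hA k (Finset.mem_Icc.1 hk).1)]
  simp_rw [hmean]
  have hint : ∀ n, Integrable (fun ω => hitCount (fun k => X k ⁻¹' A k) n ω /
      hitMean (P.map (X 0)) A n - 1) P := fun n =>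
    ((integrable_hitCount hB n).div_const _).sub (integrable_const 1)
  suffices hlim : Tendsto (fun n => ∫ ω, |hitCount (fun k => X k ⁻¹' A k) n ω /
      hitMean (P.map (X 0)) A n - 1| ∂P) atTop (𝓝 0) by
    have h2 := ENNReal.tendsto_ofReal hlim
    rw [ENNReal.ofReal_zero] at h2
    refine h2.congr fun n => ?_
    rw [eLpNorm_one_eq_lintegral_enorm, ← ofReal_integral_norm_eq_lintegral_enorm (hint n)]
    rfl
  have key : ∀ ε > 0, ∀ᶠ n in atTop, ∫ ω, |hitCount (fun k => X k ⁻¹' A k) n ω /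
      hitMean (P.map (X 0)) A n - 1| ∂P ≤ 6 * ε := by
    intro ε hε
    obtain ⟨C, hC⟩ := hdom ε hε
    obtain ⟨p, hp⟩ := ((hβ.const_mul |C|).eventually_lt_const (u := ε) (by simpa using hε)).exists
    obtain ⟨ν, hν, hνβ, hdec⟩ := exists_excess_measure_hitCount P hX hstat p
    have hνβ' : ν.real Set.univ ≤ betaMixing P X p :=
      ENNReal.toReal_le_of_le_ofReal ENNReal.toReal_nonneg hνβ
    filter_upwards [hC, hE.eventually_gt_atTop 0, hE.eventually_ge_atTop (4 * p / ε ^ 2)]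
      with n hCn hEpos hEn
    obtain ⟨M, R, hMR, hMi, hRi, hM, hR⟩ := hdec A hA n
    set e := hitMean (P.map (X 0)) A n with he
    have hpt : ∀ ω, |hitCount (fun k => X k ⁻¹' A k) n ω / e - 1| ≤
        (ε + M ω ^ 2 / (e ^ 2 * ε)) + |R ω| / e := by
      intro ω
      have h1 : hitCount (fun k => X k ⁻¹' A k) n ω / e - 1 = M ω / e + R ω / e := by
        rw [← add_div, ← hMR ω, sub_div, div_self hEpos.ne']
      rw [h1]
      refine (abs_add_le _ _).trans (add_le_add ?_ ?_)
      · have h2 : M ω ^ 2 / (e ^ 2 * ε) = |M ω / e| ^ 2 / ε := by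
          rw [sq_abs, div_pow, div_div]
        -- `t ≤ ε + t ^ 2 / ε` turns the second moment bound into a first moment bound
        rw [h2, ← sub_nonneg]
        have h3 : ε + |M ω / e| ^ 2 / ε - |M ω / e| =
            ((ε - |M ω / e|) ^ 2 + ε * |M ω / e|) / ε := by field_simp; ring
        rw [h3]
        positivity
      · rw [abs_div, abs_of_pos hEpos]
    have hint2 := (hMi.div_const (e ^ 2 * ε))
    have hint3 : Integrable (fun ω => ε + M ω ^ 2 / (e ^ 2 * ε)) P :=
      (integrable_const ε).add hint2
    calc _ ≤ ∫ ω, ((ε + M ω ^ 2 / (e ^ 2 * ε)) + |R ω| / e) ∂P :=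
          integral_mono (hint n).abs
            (hint3.add (hRi.abs.div_const e)) hpt
      _ = ε + (∫ ω, M ω ^ 2 ∂P) / (e ^ 2 * ε) + (∫ ω, |R ω| ∂P) / e := by
          rw [integral_add hint3 (hRi.abs.div_const e),
            integral_add (integrable_const ε) hint2, integral_div, integral_div]
          simp
      _ ≤ ε + ε + 4 * ε := by
          refine add_le_add (add_le_add le_rfl ?_) ?_
          · rw [div_le_iff₀ (by positivity)]
            rw [div_le_iff₀ (by positivity)] at hEn
            nlinarith [mul_le_mul_of_nonneg_right hEn hEpos.le]
          · rw [div_le_iff₀ hEpos]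
            have h4 : C * ν.real Set.univ ≤ ε :=
              (mul_le_mul (le_abs_self C) hνβ' measureReal_nonneg (abs_nonneg C)).trans hp.le
            nlinarith [hCn ν hν, mul_le_mul_of_nonneg_right h4 hEpos.le]
      _ = 6 * ε := by ring
  refine tendsto_order.2 ⟨fun a ha => Eventually.of_forall fun n =>
    ha.trans_le (integral_nonneg fun _ => abs_nonneg _), fun a ha => ?_⟩
  filter_upwards [key (a / 12) (by positivity)] with n hn
  linarith

/-! ### Uniform integrability -/

theorem normalizedHits_nonneg {E : Type*} [MeasurableSpace E] (μ : Measure E) (A : ℕ → Set E)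
    (n : ℕ) (x : E) : 0 ≤ normalizedHits μ A n x :=
  mul_nonneg (inv_nonneg.2 (hitMean_nonneg n)) (hitCount_nonneg A n x)

theorem measurable_normalizedHits {E : Type*} [MeasurableSpace E] (μ : Measure E) {A : ℕ → Set E}
    (hA : ∀ k, 0 < k → MeasurableSet (A k)) (n : ℕ) : Measurable (normalizedHits μ A n) :=
  (measurable_hitCount hA n).const_mul _

theorem integrable_normalizedHits {E : Type*} [MeasurableSpace E] (μ : Measure E) {A : ℕ → Set E}
    (hA : ∀ k, 0 < k → MeasurableSet (A k)) (n : ℕ) (ν : Measure E) [IsFiniteMeasure ν] :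
    Integrable (normalizedHits μ A n) ν :=
  (integrable_hitCount hA n).const_mul _

theorem hitMean_eq_mul_integral_normalizedHits {E : Type*} [MeasurableSpace E] {μ ν : Measure E}
    [IsFiniteMeasure μ] (hν : ν ≤ μ) {A : ℕ → Set E} (hA : ∀ k, 0 < k → MeasurableSet (A k))
    (n : ℕ) : hitMean ν A n = hitMean μ A n * ∫ x, normalizedHits μ A n x ∂ν := by
  have : IsFiniteMeasure ν := isFiniteMeasure_of_le μ hν
  simp only [normalizedHits]
  rw [integral_const_mul, integral_hitCount hA]
  rcases eq_or_ne (hitMean μ A n) 0 with h | h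
  · rw [h, zero_mul]
    exact le_antisymm (h ▸ hitMean_mono_measure hν n) (hitMean_nonneg n)
  · rw [mul_inv_cancel_left₀ h]

/-- Uniform integrability in the form in which it is used: `∫ H_n ∂ν ≤ C ν(E) + ε` for all `ν ≤ μ`. -/
theorem hitMean_le_of_uniformIntegrable {E : Type*} [MeasurableSpace E] {μ : Measure E}
    [IsFiniteMeasure μ] {A : ℕ → Set E} (hA : ∀ k, 0 < k → MeasurableSet (A k))
    (hUI : UniformIntegrable (fun n : {n : ℕ // 0 < n} => normalizedHits μ A n) 1 μ)
    {ε : ℝ} (hε : 0 < ε) :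
    ∃ C : ℝ, ∀ n, 0 < n → ∀ ν ≤ μ,
      hitMean ν A n ≤ (C * ν.real Set.univ + ε) * hitMean μ A n := by
  obtain ⟨C, hC⟩ := hUI.spec one_ne_zero ENNReal.one_ne_top hε
  refine ⟨C, fun n hn ν hν => ?_⟩
  have : IsFiniteMeasure ν := isFiniteMeasure_of_le μ hν
  rw [hitMean_eq_mul_integral_normalizedHits hν hA, mul_comm]
  refine mul_le_mul_of_nonneg_right ?_ (hitMean_nonneg n)
  set H := normalizedHits μ A n with hH
  set T : Set E := {x | C ≤ ‖H x‖₊}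
  have hT : MeasurableSet T :=
    measurableSet_le measurable_const (measurable_normalizedHits μ hA n).nnnorm
  have hHi : ∀ ρ : Measure E, IsFiniteMeasure ρ → Integrable (T.indicator H) ρ := fun ρ _ =>
    (integrable_normalizedHits μ hA n ρ).indicator hT
  have hnn : ∀ x, 0 ≤ T.indicator H x := fun x =>
    Set.indicator_nonneg (fun _ _ => normalizedHits_nonneg μ A n _) x
  have h1 : ∫ x, T.indicator H x ∂μ ≤ ε := by
    have h2 := hC ⟨n, hn⟩
    rw [eLpNorm_one_eq_lintegral_enorm, ← ofReal_integral_norm_eq_lintegral_enorm (hHi μ ‹_›),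
      ENNReal.ofReal_le_ofReal_iff hε.le] at h2
    refine le_trans (le_of_eq (integral_congr_ae (Eventually.of_forall fun x => ?_))) h2
    exact (Real.norm_of_nonneg (hnn x)).symm
  calc ∫ x, H x ∂ν ≤ ∫ x, ((C : ℝ) + T.indicator H x) ∂ν := by
        refine integral_mono (integrable_normalizedHits μ hA n ν)
          ((integrable_const _).add (hHi ν ‹_›)) fun x => ?_
        by_cases hx : x ∈ T
        · simp [Set.indicator_of_mem hx]
        · have hx' : ‖H x‖₊ < C := not_le.1 hx
          simp only [Set.indicator_of_notMem hx, add_zero]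
          exact (le_abs_self _).trans (NNReal.coe_le_coe.2 hx'.le)
    _ = C * ν.real Set.univ + ∫ x, T.indicator H x ∂ν := by
        rw [integral_add (integrable_const _) (hHi ν ‹_›), integral_const, smul_eq_mul, mul_comm]
    _ ≤ C * ν.real Set.univ + ε := by
        gcongr
        exact (integral_mono_measure hν (Eventually.of_forall hnn) (hHi μ ‹_›)).trans h1

/-! ### Thinning -/

/-- The number of hits counted by a greedy selection rule: a hit in `A (k + 1)` is counted only at
the points where the current count is at most `c` times one plus its mean. -/
noncomputable def greedyCount {E : Type*} [MeasurableSpace E] (μ : Measure E) (A : ℕ → Set E)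
    (c : ℝ) : ℕ → E → ℝ
  | 0 => fun _ => 0
  | n + 1 => fun x => greedyCount μ A c n x +
      (A (n + 1) ∩ {y | greedyCount μ A c n y ≤ c * (1 + ∫ z, greedyCount μ A c n z ∂μ)}).indicator
        (fun _ => (1 : ℝ)) x

/-- The hits kept by the greedy selection rule of `greedyCount`. -/
noncomputable def greedySet {E : Type*} [MeasurableSpace E] (μ : Measure E) (A : ℕ → Set E)
    (c : ℝ) (k : ℕ) : Set E :=
  A k ∩ {y | greedyCount μ A c (k - 1) y ≤ c * (1 + ∫ z, greedyCount μ A c (k - 1) z ∂μ)}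

theorem hitCount_greedySet {E : Type*} [MeasurableSpace E] (μ : Measure E) (A : ℕ → Set E)
    (c : ℝ) (n : ℕ) : hitCount (greedySet μ A c) n = greedyCount μ A c n := by
  induction n with
  | zero => ext x; simp [hitCount, greedyCount]
  | succ n ih =>
    ext x
    rw [hitCount_succ, ih]
    rfl

section Greedy

variable {E : Type*} [MeasurableSpace E] {μ : Measure E} {A : ℕ → Set E} {c : ℝ}

theorem measurableSet_greedySet (hA : ∀ k, 0 < k → MeasurableSet (A k)) {k : ℕ} (hk : 0 < k) :
    MeasurableSet (greedySet μ A c k) := by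
  have hm : ∀ n, Measurable (greedyCount μ A c n) := by
    intro n
    induction n with
    | zero => exact measurable_const
    | succ n ih =>
      exact ih.add (measurable_const.indicator
        ((hA _ n.succ_pos).inter (measurableSet_le ih measurable_const)))
  exact (hA k hk).inter (measurableSet_le (hm _) measurable_const)

variable [IsFiniteMeasure μ]

theorem mem_greedySet_succ_iff (hA : ∀ k, 0 < k → MeasurableSet (A k)) {n : ℕ} {x : E} :
    x ∈ greedySet μ A c (n + 1) ↔ x ∈ A (n + 1) ∧
      hitCount (greedySet μ A c) n x ≤ c * (1 + hitMean μ (greedySet μ A c) n) := by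
  rw [← integral_hitCount (fun k hk => measurableSet_greedySet hA hk), hitCount_greedySet]
  rfl

theorem hitCount_greedySet_le (hA : ∀ k, 0 < k → MeasurableSet (A k)) (hc : 0 ≤ c) (n : ℕ)
    (x : E) :
    hitCount (greedySet μ A c) n x ≤ c * (1 + hitMean μ (greedySet μ A c) n) + 1 := by
  induction n with
  | zero => simp only [hitCount, hitMean]; simp; positivity
  | succ n ih =>
    have hmono : c * (1 + hitMean μ (greedySet μ A c) n) ≤
        c * (1 + hitMean μ (greedySet μ A c) (n + 1)) := by
      gcongr
      exact hitMean_mono n.le_succ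
    rw [hitCount_succ]
    by_cases hx : x ∈ greedySet μ A c (n + 1)
    · rw [Set.indicator_of_mem hx]
      linarith [((mem_greedySet_succ_iff hA).1 hx).2]
    · rw [Set.indicator_of_notMem hx]
      linarith

/-- A point hit infinitely often would see its greedy count stay below the threshold forever only
if all late hits were counted, so its final count reaches the threshold. If the selected sets had
total mass `e < ∞`, integrating over `limsup A` would give `e ≥ μ (limsup A) * c * (1 + e)`, which
fails when `c = 1 / μ (limsup A)`. -/
theorem divergentMass_greedySet (hA : ∀ k, 0 < k → MeasurableSet (A k))
    (hpos : 0 < μ (limsup A atTop)) (hc : c = (μ.real (limsup A atTop))⁻¹) :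
    DivergentMass μ (greedySet μ A c) := by
  set D := greedySet μ A c with hD
  set l := μ.real (limsup A atTop) with hl
  have hl0 : 0 < l := ENNReal.toReal_pos hpos.ne' (measure_ne_top _ _)
  have hc0 : 0 < c := hc ▸ inv_pos.2 hl0
  have hDm : ∀ k, 0 < k → MeasurableSet (D k) := fun k hk => measurableSet_greedySet hA hk
  by_contra hdiv
  have hsum : Summable fun k => μ.real (D (k + 1)) := ENNReal.summable_toReal hdiv
  set e := ∑' k, μ.real (D (k + 1)) with he
  -- the total count, with values in `[0, ∞]`
  have htot : ∫⁻ x, ∑' k, (D (k + 1)).indicator (fun _ => (1 : ℝ≥0∞)) x ∂μ = ENNReal.ofReal e := by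
    rw [lintegral_tsum fun k =>
      (measurable_const.indicator (hDm _ k.succ_pos)).aemeasurable, he,
      ENNReal.ofReal_tsum_of_nonneg (fun _ => measureReal_nonneg) hsum]
    refine tsum_congr fun k => ?_
    rw [lintegral_indicator_const (hDm _ k.succ_pos), one_mul, ofReal_measureReal]
  have hcount : ∀ n x, ENNReal.ofReal (hitCount D n x) ≤
      ∑' k, (D (k + 1)).indicator (fun _ => (1 : ℝ≥0∞)) x := by
    intro n x
    have h1 : ENNReal.ofReal (hitCount D n x) =
        ∑ k ∈ Finset.range n, (D (k + 1)).indicator (fun _ => (1 : ℝ≥0∞)) x := by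
      induction n with
      | zero => simp [hitCount]
      | succ n ih =>
        rw [hitCount_succ, ENNReal.ofReal_add (hitCount_nonneg D n x)
          (Set.indicator_nonneg (fun _ _ => zero_le_one) x), ih, Finset.sum_range_succ]
        congr 1
        by_cases hx : x ∈ D (n + 1) <;> simp [hx]
    rw [h1]
    exact ENNReal.sum_le_tsum _
  have hkey : ∀ m, 1 + hitMean μ D m ≤ e := by
    intro m
    have hsub : limsup A atTop ⊆ {x | ENNReal.ofReal (c * (1 + hitMean μ D m)) ≤
        ∑' k, (D (k + 1)).indicator (fun _ => (1 : ℝ≥0∞)) x} := by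
      intro x hx
      rw [mem_limsup_iff_frequently_mem, frequently_atTop] at hx
      by_contra hlt
      have hlt' : ∀ n, hitCount D n x < c * (1 + hitMean μ D m) := fun n =>
        (ENNReal.ofReal_lt_ofReal_iff_of_nonneg (hitCount_nonneg D n x)).1
          ((hcount n x).trans_lt (not_le.1 hlt))
      -- all hits after time `m` are then counted, and there are infinitely many of them
      have hgrow : ∀ j : ℕ, ∃ n, (j : ℝ) ≤ hitCount D n x := by
        intro j
        induction j with
        | zero => exact ⟨0, by simpa using hitCount_nonneg D 0 x⟩
        | succ j ih =>
          obtain ⟨n, hn⟩ := ih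
          obtain ⟨k, hk, hxk⟩ := hx (max n m + 1)
          obtain ⟨k, rfl⟩ : ∃ k', k = k' + 1 := ⟨k - 1, by lia⟩
          have hkn : max n m ≤ k := by lia
          refine ⟨k + 1, ?_⟩
          have hmem : x ∈ D (k + 1) := by
            refine (mem_greedySet_succ_iff hA).2 ⟨hxk, (hlt' k).le.trans ?_⟩
            gcongr
            exact hitMean_mono ((le_max_right n m).trans hkn)
          rw [hitCount_succ, Set.indicator_of_mem hmem]
          push_cast
          have := hitCount_mono D x ((le_max_left n m).trans hkn)
          simp only at this
          linarith
      obtain ⟨j, hj⟩ := exists_nat_gt (c * (1 + hitMean μ D m))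
      obtain ⟨n, hn⟩ := hgrow j
      exact absurd (hlt' n) (not_lt.2 (hj.le.trans hn))
    have hmarkov := mul_meas_ge_le_lintegral (μ := μ)
      (f := fun x => ∑' k, (D (k + 1)).indicator (fun _ => (1 : ℝ≥0∞)) x)
      (Measurable.tsum fun k => measurable_const.indicator (hDm (k + 1) k.succ_pos))
      (ENNReal.ofReal (c * (1 + hitMean μ D m)))
    rw [htot] at hmarkov
    have h2 := (mul_le_mul_right (measure_mono hsub)
      (ENNReal.ofReal (c * (1 + hitMean μ D m)))).trans hmarkov
    rw [← ofReal_measureReal, ← ENNReal.ofReal_mul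
      (mul_nonneg hc0.le (add_nonneg zero_le_one (hitMean_nonneg m))),
      ENNReal.ofReal_le_ofReal_iff (tsum_nonneg fun _ => measureReal_nonneg)] at h2
    calc 1 + hitMean μ D m = c * (1 + hitMean μ D m) * l := by rw [hc]; field_simp
      _ ≤ e := h2
  have hlim : Tendsto (fun m => 1 + hitMean μ D m) atTop (𝓝 (1 + e)) := by
    have : hitMean μ D = fun n => ∑ k ∈ Finset.range n, μ.real (D (k + 1)) :=
      funext hitMean_eq_sum_range
    rw [this]
    exact hsum.hasSum.tendsto_sum_nat.const_add 1
  linarith [le_of_tendsto' hlim hkey]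

end Greedy

section Criteria

variable {Ω E : Type*} [MeasurableSpace Ω] [MeasurableSpace E] [StandardBorelSpace E] [Nonempty E]
  {P : Measure Ω} [IsProbabilityMeasure P] {X : ℤ → Ω → E} {A : ℕ → Set E}

theorem isL1BorelCantelli_of_uniformIntegrable (hX : ∀ i, Measurable (X i))
    (hstat : StrictlyStationary P X)
    (hβ : Tendsto (fun n : ℕ => betaMixing P X n) atTop (𝓝 0))
    (hA : ∀ k, 0 < k → MeasurableSet (A k)) (hdiv : DivergentMass (P.map (X 0)) A)
    (hUI : UniformIntegrable
      (fun n : {n : ℕ // 0 < n} => normalizedHits (P.map (X 0)) A n) 1 (P.map (X 0))) :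
    IsL1BorelCantelli P fun k => X k ⁻¹' A k := by
  have : IsProbabilityMeasure (P.map (X 0)) := Measure.isProbabilityMeasure_map (hX 0).aemeasurable
  refine isL1BorelCantelli_of_dominated P hX hstat hβ hA hdiv fun ε hε => ?_
  obtain ⟨C, hC⟩ := hitMean_le_of_uniformIntegrable hA hUI hε
  exact ⟨C, (eventually_gt_atTop 0).mono hC⟩

/-- The greedy selection keeps the normalized counts bounded, so that the `L¹` criterion applies to
the selected subsets of the `A k`. -/
theorem isBorelCantelli_of_limsup_pos (hX : ∀ i, Measurable (X i))
    (hstat : StrictlyStationary P X)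
    (hβ : Tendsto (fun n : ℕ => betaMixing P X n) atTop (𝓝 0))
    (hA : ∀ k, 0 < k → MeasurableSet (A k)) (hpos : 0 < P.map (X 0) (limsup A atTop)) :
    IsBorelCantelli P fun k => X k ⁻¹' A k := by
  have : IsProbabilityMeasure (P.map (X 0)) := Measure.isProbabilityMeasure_map (hX 0).aemeasurable
  set μ := P.map (X 0) with hμ
  set c := (μ.real (limsup A atTop))⁻¹ with hc
  have hc0 : 0 ≤ c := inv_nonneg.2 measureReal_nonneg
  set D := greedySet μ A c with hD
  have hDm : ∀ k, 0 < k → MeasurableSet (D k) := fun k hk => measurableSet_greedySet hA hk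
  have hdiv : DivergentMass μ D := divergentMass_greedySet hA hpos hc
  have hL1 : IsL1BorelCantelli P fun k : ℕ => X k ⁻¹' D k := by
    refine isL1BorelCantelli_of_dominated P hX hstat hβ hDm hdiv fun ε hε => ⟨2 * c + 1, ?_⟩
    filter_upwards [(divergentMass_iff_tendsto_hitMean.1 hdiv).eventually_ge_atTop 1]
      with n hn ν hν
    have : IsFiniteMeasure ν := isFiniteMeasure_of_le μ hν
    calc hitMean ν D n = ∫ x, hitCount D n x ∂ν := (integral_hitCount hDm n).symm
      _ ≤ ∫ _, (2 * c + 1) * hitMean μ D n ∂ν := by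
          refine integral_mono (integrable_hitCount hDm n) (integrable_const _) fun x => ?_
          refine (hitCount_greedySet_le hA hc0 n x).trans ?_
          nlinarith [mul_le_mul_of_nonneg_left hn hc0]
      _ = (2 * c + 1) * ν.real Set.univ * hitMean μ D n := by
          rw [integral_const, smul_eq_mul]; ring
      _ ≤ ((2 * c + 1) * ν.real Set.univ + ε) * hitMean μ D n := by
          refine mul_le_mul_of_nonneg_right ?_ (hitMean_nonneg n)
          linarith
  have hBC := hL1.isBorelCantelli fun k hk => hX k (hDm k hk)
  refine le_antisymm prob_le_one (hBC.symm.le.trans (measure_mono ?_))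
  refine limsup_le_limsup (Eventually.of_forall fun k => ?_)
  exact Set.preimage_mono Set.inter_subset_left

end Criteria

/-! ### Quantile bounds -/

section Quantile

variable {E : Type*} [MeasurableSpace E] {μ : Measure E} {Z : E → ℝ}

theorem tailQuantile_nonneg (u : ℝ) : 0 ≤ tailQuantile μ Z u :=
  Real.sInf_nonneg fun _ ht => ht.1

theorem tailQuantile_le_of_measure_le {t u : ℝ} (ht : 0 ≤ t) (h : μ.real {x | t < Z x} ≤ u) :
    tailQuantile μ Z u ≤ t :=
  csInf_le ⟨0, fun _ hs => hs.1⟩ ⟨ht, h⟩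

theorem tailQuantile_set_nonempty {K : ℝ} (hK : ∀ x, Z x ≤ K) {u : ℝ} (hu : 0 ≤ u) :
    {t : ℝ | 0 ≤ t ∧ μ.real {x | t < Z x} ≤ u}.Nonempty := by
  refine ⟨max K 0, le_max_right _ _, ?_⟩
  have : {x | max K 0 < Z x} = ∅ := by
    ext x
    simp only [Set.mem_ofPred_eq, Set.mem_empty_iff_false, iff_false, not_lt]
    exact (hK x).trans (le_max_left _ _)
  rw [this, measureReal_empty]
  exact hu

theorem tailQuantile_antitoneOn {K : ℝ} (hK : ∀ x, Z x ≤ K) :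
    AntitoneOn (tailQuantile μ Z) (Set.Ici 0) := fun _ hu _ _ huv =>
  csInf_le_csInf ⟨0, fun _ hs => hs.1⟩ (tailQuantile_set_nonempty hK hu)
    fun _ ht => ⟨ht.1, ht.2.trans huv⟩

theorem le_tailQuantile_of_lt_measure [IsFiniteMeasure μ] {K : ℝ} (hK : ∀ x, Z x ≤ K) {t u : ℝ}
    (hu : 0 ≤ u) (h : u < μ.real {x | t < Z x}) : t ≤ tailQuantile μ Z u := by
  refine le_csInf (tailQuantile_set_nonempty hK hu) fun s hs => ?_
  by_contra hst
  exact absurd (h.trans_le (measureReal_mono fun x hx => (not_le.1 hst).trans hx))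
    (not_lt.2 hs.2)

theorem intervalIntegrable_tailQuantile {K : ℝ} (hK : ∀ x, Z x ≤ K) {b : ℝ} (hb : 0 ≤ b) :
    IntervalIntegrable (tailQuantile μ Z) volume 0 b :=
  ((tailQuantile_antitoneOn hK).mono fun _ hs => (Set.uIcc_of_le hb ▸ hs).1).intervalIntegrable

theorem ofReal_intervalIntegral_tailQuantile {K : ℝ} (hK : ∀ x, Z x ≤ K) {b : ℝ} (hb : 0 ≤ b) :
    ENNReal.ofReal (∫ s in (0 : ℝ)..b, tailQuantile μ Z s) =
      ∫⁻ s in Set.Ioc 0 b, ENNReal.ofReal (tailQuantile μ Z s) := by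
  rw [intervalIntegral.integral_of_le hb]
  exact ofReal_integral_eq_lintegral_ofReal (intervalIntegrable_tailQuantile hK hb).1
    (Eventually.of_forall tailQuantile_nonneg)

variable [IsFiniteMeasure μ]

/-- Among the measures `ν ≤ μ` of mass at most `b`, none integrates `Z` to more than the integral of
the quantile function over `(0, b)`: by the layer cake formula both sides are compared through
`ν {Z > t} ≤ min b (μ {Z > t})`. -/
theorem integral_le_integral_tailQuantile {K : ℝ} (hZ : Measurable Z) (hZ0 : ∀ x, 0 ≤ Z x)
    (hK : ∀ x, Z x ≤ K) {ν : Measure E} (hν : ν ≤ μ) {b : ℝ} (hb : 0 ≤ b)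
    (hνb : ν Set.univ ≤ ENNReal.ofReal b) :
    ∫ x, Z x ∂ν ≤ ∫ s in (0 : ℝ)..b, tailQuantile μ Z s := by
  have : IsFiniteMeasure ν := isFiniteMeasure_of_le μ hν
  have hZi : Integrable Z ν := Integrable.of_bound hZ.aestronglyMeasurable K
    (Eventually.of_forall fun x => by rw [Real.norm_of_nonneg (hZ0 x)]; exact hK x)
  rw [← ENNReal.ofReal_le_ofReal_iff (intervalIntegral.integral_nonneg hb fun s _ =>
      tailQuantile_nonneg s), ofReal_intervalIntegral_tailQuantile hK hb,
    ofReal_integral_eq_lintegral_ofReal hZi (Eventually.of_forall hZ0),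
    lintegral_eq_lintegral_meas_lt ν (Eventually.of_forall hZ0) hZ.aemeasurable,
    lintegral_eq_lintegral_meas_le _ (Eventually.of_forall tailQuantile_nonneg)
      (intervalIntegrable_tailQuantile hK hb).1.aestronglyMeasurable.aemeasurable]
  refine lintegral_mono fun t => ?_
  calc ν {x | t < Z x} ≤ ENNReal.ofReal (min b (μ.real {x | t < Z x})) := by
        rw [ENNReal.ofReal_min, ofReal_measureReal]
        exact le_min ((measure_mono (Set.subset_univ _)).trans hνb) (hν _)
    _ = volume (Set.Ioo 0 (min b (μ.real {x | t < Z x}))) := by rw [Real.volume_Ioo, sub_zero]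
    _ = (volume.restrict (Set.Ioc 0 b)) (Set.Ioo 0 (min b (μ.real {x | t < Z x}))) := by
        rw [Measure.restrict_eq_self]
        exact fun s hs => ⟨hs.1, (hs.2.trans_le (min_le_left _ _)).le⟩
    _ ≤ _ := measure_mono fun s hs =>
        le_tailQuantile_of_lt_measure hK hs.1.le (hs.2.trans_le (min_le_right _ _))

/-- This bound makes the set of reals in the definition of `quantileStar` bounded, so that its
supremum is not a junk value. -/
theorem integral_tailQuantile_le {K : ℝ} (hZ : Measurable Z) (hZ0 : ∀ x, 0 ≤ Z x)
    (hK : ∀ x, Z x ≤ K) {b : ℝ} (hb : 0 ≤ b) :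
    ∫ s in (0 : ℝ)..b, tailQuantile μ Z s ≤ ∫ x, Z x ∂μ := by
  have hZi : Integrable Z μ := Integrable.of_bound hZ.aestronglyMeasurable K
    (Eventually.of_forall fun x => by rw [Real.norm_of_nonneg (hZ0 x)]; exact hK x)
  rw [← ENNReal.ofReal_le_ofReal_iff (integral_nonneg hZ0),
    ofReal_intervalIntegral_tailQuantile hK hb,
    ofReal_integral_eq_lintegral_ofReal hZi (Eventually.of_forall hZ0),
    lintegral_eq_lintegral_meas_lt μ (Eventually.of_forall hZ0) hZ.aemeasurable,
    lintegral_eq_lintegral_meas_lt _ (Eventually.of_forall tailQuantile_nonneg)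
      (intervalIntegrable_tailQuantile hK hb).1.aestronglyMeasurable.aemeasurable]
  refine setLIntegral_mono' measurableSet_Ioi fun t ht => ?_
  calc (volume.restrict (Set.Ioc 0 b)) {s | t < tailQuantile μ Z s}
      ≤ volume (Set.Ioo 0 (μ.real {x | t < Z x})) := by
        rw [Measure.restrict_apply' measurableSet_Ioc]
        refine measure_mono fun s hs => ⟨hs.2.1, ?_⟩
        by_contra hcon
        exact absurd hs.1 (not_lt.2 (tailQuantile_le_of_measure_le (le_of_lt ht) (not_lt.1 hcon)))
    _ = μ {x | t < Z x} := by rw [Real.volume_Ioo, sub_zero, ofReal_measureReal]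

end Quantile

theorem normalizedHits_le {E : Type*} [MeasurableSpace E] (μ : Measure E) (A : ℕ → Set E)
    (n : ℕ) (x : E) : normalizedHits μ A n x ≤ (hitMean μ A n)⁻¹ * n :=
  mul_le_mul_of_nonneg_left (hitCount_le A n x) (inv_nonneg.2 (hitMean_nonneg n))

theorem mul_quantileStar_nonneg {E : Type*} [MeasurableSpace E] (μ : Measure E) (A : ℕ → Set E)
    {b : ℝ} (hb : 0 ≤ b) : 0 ≤ b * quantileStar μ A b := by
  rw [quantileStar]
  split_ifs with h
  · simp
  · refine mul_nonneg hb (mul_nonneg (inv_nonneg.2 hb) (Real.iSup_nonneg fun n => ?_))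
    exact intervalIntegral.integral_nonneg hb fun s _ => tailQuantile_nonneg s

/-- The mass received by the sets `A k` from a small measure `ν ≤ μ`, in terms of `Q*`. -/
theorem hitMean_le_mul_quantileStar {E : Type*} [MeasurableSpace E] {μ ν : Measure E}
    [IsFiniteMeasure μ] {A : ℕ → Set E} (hA : ∀ k, 0 < k → MeasurableSet (A k)) (hν : ν ≤ μ)
    {b : ℝ} (hb : 0 ≤ b) (hνb : ν Set.univ ≤ ENNReal.ofReal b) {n : ℕ} (hn : 0 < n) :
    hitMean ν A n ≤ b * quantileStar μ A b * hitMean μ A n := by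
  rw [hitMean_eq_mul_integral_normalizedHits hν hA, mul_comm]
  refine mul_le_mul_of_nonneg_right ?_ (hitMean_nonneg n)
  have h1 := integral_le_integral_tailQuantile (measurable_normalizedHits μ hA n)
    (normalizedHits_nonneg μ A n) (normalizedHits_le μ A n) hν hb hνb
  refine h1.trans ?_
  rw [quantileStar]
  split_ifs with h0
  · simp [h0]
  rw [mul_inv_cancel_left₀ h0]
  refine le_ciSup (f := fun n : {n : ℕ // 0 < n} =>
    ∫ s in (0 : ℝ)..b, tailQuantile μ (normalizedHits μ A n) s) ⟨1, ?_⟩ ⟨n, hn⟩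
  rintro _ ⟨m, rfl⟩
  refine (integral_tailQuantile_le (measurable_normalizedHits μ hA m)
    (normalizedHits_nonneg μ A m) (normalizedHits_le μ A m) hb).trans ?_
  simp only [normalizedHits]
  rw [integral_const_mul, integral_hitCount hA]
  exact inv_mul_le_one

/-! ### Almost sure convergence -/

/-- If `∑ δ j / j` converges, one index can be chosen in each dyadic block `[2 ^ s, 2 ^ (s + 1))`
so that `δ` is summable along the chosen indices. No monotonicity of `δ` is used. -/
theorem exists_dyadic_summable_comp {δ : ℕ → ℝ} (hδ : ∀ j, 0 ≤ δ j)
    (h : Summable fun j : ℕ => ((j + 1 : ℕ) : ℝ)⁻¹ * δ (j + 1)) :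
    ∃ q : ℕ → ℕ, (∀ s, q s ≤ 2 * 2 ^ s) ∧ Summable fun s => δ (q s) := by
  have hne : ∀ s : ℕ, (Finset.Ico (2 ^ s) (2 ^ (s + 1))).Nonempty := fun s =>
    Finset.nonempty_Ico.2 (Nat.pow_lt_pow_right one_lt_two s.lt_succ_self)
  choose q hq hmin using fun s => (Finset.Ico (2 ^ s) (2 ^ (s + 1))).exists_min_image δ (hne s)
  refine ⟨q, fun s => ?_, ?_⟩
  · rw [← pow_succ']
    exact (Finset.mem_Ico.1 (hq s)).2.le
  · -- the reciprocals of the integers in a dyadic block add up to at least `1 / 2`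
    have hblock : ∀ s, δ (q s) ≤ 2 * ∑ j ∈ Finset.Ico (2 ^ s : ℕ) (2 ^ (s + 1)), (j : ℝ)⁻¹ * δ j := by
      intro s
      have h1 : ∀ j ∈ Finset.Ico (2 ^ s : ℕ) (2 ^ (s + 1)),
          ((2 : ℝ) ^ (s + 1))⁻¹ * δ (q s) ≤ (j : ℝ)⁻¹ * δ j := by
        intro j hj
        have hj' := Finset.mem_Ico.1 hj
        have hj0 : (0 : ℝ) < j := by exact_mod_cast (Nat.two_pow_pos s).trans_le hj'.1
        refine mul_le_mul (inv_anti₀ hj0 ?_) (hmin s j hj) (hδ _) (inv_nonneg.2 hj0.le)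
        exact_mod_cast hj'.2.le
      have h2 := Finset.card_nsmul_le_sum _ _ _ h1
      have hcard : (Finset.Ico (2 ^ s) (2 ^ (s + 1))).card = 2 ^ s := by
        rw [Nat.card_Ico, pow_succ]; lia
      rw [hcard, nsmul_eq_mul] at h2
      calc δ (q s) = 2 * (((2 ^ s : ℕ) : ℝ) * (((2 : ℝ) ^ (s + 1))⁻¹ * δ (q s))) := by
            push_cast; rw [pow_succ]; field_simp
        _ ≤ _ := by gcongr
    refine summable_of_sum_range_le (c := 2 * ∑' j : ℕ, ((j + 1 : ℕ) : ℝ)⁻¹ * δ (j + 1))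
      (fun s => hδ _) fun n => ?_
    have htel : ∀ n : ℕ, ∑ s ∈ Finset.range n, ∑ j ∈ Finset.Ico (2 ^ s : ℕ) (2 ^ (s + 1)),
        (j : ℝ)⁻¹ * δ j = ∑ j ∈ Finset.Ico 1 (2 ^ n : ℕ), (j : ℝ)⁻¹ * δ j := by
      intro n
      induction n with
      | zero => simp
      | succ n ih =>
        rw [Finset.sum_range_succ, ih, Finset.sum_Ico_consecutive _ Nat.one_le_two_pow
          (Nat.pow_le_pow_right two_pos n.le_succ)]
    calc ∑ s ∈ Finset.range n, δ (q s)
        ≤ 2 * ∑ j ∈ Finset.Ico 1 (2 ^ n : ℕ), (j : ℝ)⁻¹ * δ j := by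
          rw [← htel, Finset.mul_sum]
          exact Finset.sum_le_sum fun s _ => hblock s
      _ = 2 * ∑ j ∈ Finset.range (2 ^ n - 1), ((j + 1 : ℕ) : ℝ)⁻¹ * δ (j + 1) := by
          rw [Finset.sum_Ico_eq_sum_range]
          simp_rw [add_comm 1]
      _ ≤ _ := by
          gcongr
          exact h.sum_le_tsum _ fun j _ => mul_nonneg (by positivity) (hδ _)

theorem Summable.comp_div {g : ℕ → ℝ} (hg : Summable g) (h0 : ∀ s, 0 ≤ g s) {m : ℕ} (hm : 0 < m) :
    Summable fun i => g (i / m) := by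
  have : NeZero m := ⟨hm.ne'⟩
  have h1 : Summable fun x : ℕ × Fin m => g x.1 * 1 :=
    hg.mul_of_nonneg (hasSum_fintype _).summable h0 fun _ => zero_le_one
  exact ((Nat.divModEquiv m).summable_iff.2 h1).congr fun i => by simp [Nat.divModEquiv]

theorem ae_tendsto_zero_of_summable_integral {Ω : Type*} [MeasurableSpace Ω] {P : Measure Ω}
    {f : ℕ → Ω → ℝ} (hf : ∀ i, Integrable (f i) P) (h0 : ∀ i ω, 0 ≤ f i ω)
    (hs : Summable fun i => ∫ ω, f i ω ∂P) :
    ∀ᵐ ω ∂P, Tendsto (fun i => f i ω) atTop (𝓝 0) := by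
  have hm : ∀ i, AEMeasurable (fun ω => ENNReal.ofReal (f i ω)) P := fun i =>
    (hf i).aestronglyMeasurable.aemeasurable.ennreal_ofReal
  have h1 : ∫⁻ ω, ∑' i, ENNReal.ofReal (f i ω) ∂P ≠ ∞ := by
    rw [lintegral_tsum hm]
    simp_rw [← ofReal_integral_eq_lintegral_ofReal (hf _) (Eventually.of_forall (h0 _))]
    exact hs.tsum_ofReal_ne_top
  filter_upwards [ae_lt_top' (AEMeasurable.tsum hm) h1] with ω hω
  have h2 := (ENNReal.tendsto_toReal ENNReal.zero_ne_top).comp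
    (ENNReal.tendsto_atTop_zero_of_tsum_ne_top hω.ne)
  refine h2.congr fun i => ?_
  exact ENNReal.toReal_ofReal (h0 i ω)

/-- If `N K` is the first time at which `e` reaches the level `K`, then `S / e → 1` as soon as
`S (N K) / K → 1`. -/
theorem tendsto_div_of_tendsto_crossing {e S : ℕ → ℝ} {N : ℕ → ℕ} (hS : Monotone S)
    (hS0 : ∀ n, 0 ≤ S n) (hmono : Monotone e) (he : Tendsto e atTop atTop)
    (hN : ∀ K : ℕ, (K : ℝ) ≤ e (N K)) (heN : ∀ n K : ℕ, (K : ℝ) ≤ e n → N K ≤ n)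
    (h : Tendsto (fun K => S (N K) / K) atTop (𝓝 1)) :
    Tendsto (fun n => S n / e n) atTop (𝓝 1) := by
  have hfloor : Tendsto (fun n => ⌊e n⌋₊) atTop atTop := tendsto_nat_floor_atTop.comp he
  have hratio : Tendsto (fun K : ℕ => (K : ℝ) / (K + 1)) atTop (𝓝 1) :=
    tendsto_natCast_div_add_atTop (1 : ℝ)
  have hlow : Tendsto (fun K : ℕ => S (N K) / (K + 1)) atTop (𝓝 1) := by
    have := h.mul hratio
    rw [one_mul] at this
    refine this.congr' ?_
    filter_upwards [eventually_gt_atTop 0] with K hK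
    have : (0 : ℝ) < K := by exact_mod_cast hK
    field_simp
  have hup : Tendsto (fun K : ℕ => S (N (K + 1)) / K) atTop (𝓝 1) := by
    have h1 := ((tendsto_add_atTop_iff_nat 1).2 h).div hratio one_ne_zero
    rw [div_one] at h1
    refine h1.congr' ?_
    filter_upwards [eventually_gt_atTop 0] with K hK
    have : (0 : ℝ) < K := by exact_mod_cast hK
    simp only [Pi.div_apply]
    push_cast
    field_simp
  refine tendsto_of_tendsto_of_tendsto_of_le_of_le' (hlow.comp hfloor) (hup.comp hfloor) ?_ ?_
  · filter_upwards [he.eventually_ge_atTop 1] with n hn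
    have h1 := Nat.floor_le (zero_le_one.trans hn)
    exact div_le_div₀ (hS0 _) (hS (heN n _ h1)) (zero_lt_one.trans_le hn)
      (Nat.lt_floor_add_one _).le
  · filter_upwards [he.eventually_ge_atTop 1] with n hn
    have h1 := Nat.floor_le (zero_le_one.trans hn)
    have h2 : (0 : ℝ) < ⌊e n⌋₊ := by exact_mod_cast Nat.floor_pos.2 hn
    refine div_le_div₀ (hS0 _) (hS ?_) h2 h1
    by_contra hlt
    have h3 := (hN _).trans (hmono (not_le.1 hlt).le)
    push_cast at h3
    exact absurd h3 (not_le.2 (Nat.lt_floor_add_one _))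

theorem betaMixing_nonneg {Ω E : Type*} [MeasurableSpace Ω] [MeasurableSpace E]
    [StandardBorelSpace E] [Nonempty E] (P : Measure Ω) [IsFiniteMeasure P] (X : ℤ → Ω → E)
    (n : ℕ) : 0 ≤ betaMixing P X n :=
  ENNReal.toReal_nonneg

/-- Almost sure convergence along the crossing times of the levels `⌊a ^ i⌋`, where `a ^ m = 4`.
The gap used at step `i` is of order `2 ^ (i / m) ≈ √(E_n)`: the second moments of the `M` part are
then summable geometrically, and the first moments of the `R` part by the choice of the gaps. -/
theorem ae_tendsto_hitCount_crossing {Ω E : Type*} [MeasurableSpace Ω]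
    [MeasurableSpace E] [StandardBorelSpace E] [Nonempty E]
    {P : Measure Ω} [IsProbabilityMeasure P] {X : ℤ → Ω → E} (hX : ∀ i, Measurable (X i))
    (hstat : StrictlyStationary P X)
    {A : ℕ → Set E} (hA : ∀ k, 0 < k → MeasurableSet (A k)) {N : ℕ → ℕ}
    (hN : ∀ K : ℕ, (K : ℝ) ≤ hitMean (P.map (X 0)) A (N K))
    (hN' : ∀ K : ℕ, hitMean (P.map (X 0)) A (N K) ≤ K + 1)
    {q : ℕ → ℕ} (hq : ∀ s, q s ≤ 2 * 2 ^ s)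
    (hqs : Summable fun s =>
      betaMixing P X (q s) * quantileStar (P.map (X 0)) A (betaMixing P X (q s)))
    {m : ℕ} (hm : 0 < m) {a : ℝ} (ha : 1 < a) (ham : a ^ m = 4) :
    ∀ᵐ ω ∂P, Tendsto (fun i : ℕ => hitCount (fun k => X k ⁻¹' A k) (N ⌊a ^ i⌋₊) ω / ⌊a ^ i⌋₊)
      atTop (𝓝 1) := by
  have : IsProbabilityMeasure (P.map (X 0)) := Measure.isProbabilityMeasure_map (hX 0).aemeasurable
  set μ := P.map (X 0) with hμ
  set δ : ℕ → ℝ := fun p => betaMixing P X p * quantileStar μ A (betaMixing P X p) with hδ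
  have hδ0 : ∀ p, 0 ≤ δ p := fun p => mul_quantileStar_nonneg μ A (betaMixing_nonneg P X p)
  set e : ℕ → ℝ := fun i => hitMean μ A (N ⌊a ^ i⌋₊) with he
  have hai : ∀ i : ℕ, 1 ≤ a ^ i := fun i => one_le_pow₀ ha.le
  have hfl1 : ∀ i : ℕ, (1 : ℝ) ≤ ⌊a ^ i⌋₊ := fun i => by
    exact_mod_cast Nat.floor_pos.2 (hai i)
  have hepos : ∀ i, 0 < e i := fun i => zero_lt_one.trans_le ((hfl1 i).trans (hN _))
  have hlarge : ∀ i : ℕ, (4 : ℝ) ^ (i / m) ≤ 2 * e i := fun i => by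
    have h1 : (4 : ℝ) ^ (i / m) ≤ a ^ i := by
      rw [← ham, ← pow_mul]
      exact pow_le_pow_right₀ ha.le (Nat.mul_div_le i m)
    have h2 := (Nat.lt_floor_add_one (a ^ i)).le
    have h3 := hN ⌊a ^ i⌋₊
    have h4 := hfl1 i
    simp only [he]
    linarith
  have hdec : ∀ i : ℕ, ∃ M R : Ω → ℝ,
      (∀ ω, hitCount (fun k => X k ⁻¹' A k) (N ⌊a ^ i⌋₊) ω - e i = M ω + R ω) ∧
      Integrable (fun ω => M ω ^ 2) P ∧ Integrable R P ∧
      ∫ ω, M ω ^ 2 ∂P ≤ 4 * q (i / m) * e i ∧ ∫ ω, |R ω| ∂P ≤ 2 * (δ (q (i / m)) * e i) := by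
    intro i
    obtain ⟨ν, hν, hνβ, hd⟩ := exists_excess_measure_hitCount P hX hstat (q (i / m))
    obtain ⟨M, R, h1, h2, h3, h4, h5⟩ := hd A hA (N ⌊a ^ i⌋₊)
    refine ⟨M, R, h1, h2, h3, h4, h5.trans ?_⟩
    have hn0 : 0 < N ⌊a ^ i⌋₊ := by
      by_contra hcon
      have h6 := hepos i
      simp only [he, Nat.eq_zero_of_not_pos hcon, hitMean] at h6
      simp at h6
    have := hitMean_le_mul_quantileStar hA hν (betaMixing_nonneg P X _) hνβ hn0
    exact mul_le_mul_of_nonneg_left this zero_le_two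
  choose M R hMR hMi hRi hM hR using hdec
  have hsumM : Summable fun i => ∫ ω, M i ω ^ 2 / e i ^ 2 ∂P := by
    have hgeo : Summable fun i : ℕ => 16 * (1 / 2 : ℝ) ^ (i / m) :=
      (summable_geometric_two.comp_div (fun s => by positivity) hm).mul_left 16
    refine hgeo.of_nonneg_of_le (fun i => integral_nonneg fun ω => by positivity) fun i => ?_
    rw [integral_div, div_le_iff₀ (pow_pos (hepos i) 2)]
    refine (hM i).trans ?_
    have hqi : (q (i / m) : ℝ) ≤ 2 * 2 ^ (i / m) := by exact_mod_cast hq (i / m)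
    have h4 : (2 : ℝ) ^ (i / m) = (1 / 2) ^ (i / m) * 4 ^ (i / m) := by
      rw [← mul_pow]; norm_num
    have h5 : (q (i / m) : ℝ) ≤ 2 * ((1 / 2) ^ (i / m) * (2 * e i)) := by
      refine hqi.trans ?_
      rw [h4]
      gcongr
      exact hlarge i
    nlinarith [mul_le_mul_of_nonneg_right h5 (hepos i).le]
  have hsumR : Summable fun i => ∫ ω, |R i ω| / e i ∂P := by
    refine ((hqs.comp_div (fun s => hδ0 _) hm).mul_left 2).of_nonneg_of_le
      (fun i => integral_nonneg fun ω => div_nonneg (abs_nonneg _) (hepos i).le) fun i => ?_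
    rw [integral_div, div_le_iff₀ (hepos i), mul_assoc]
    exact hR i
  have hKtop : Tendsto (fun i : ℕ => (⌊a ^ i⌋₊ : ℝ)) atTop atTop :=
    tendsto_natCast_atTop_atTop.comp
      (tendsto_nat_floor_atTop.comp (tendsto_pow_atTop_atTop_of_one_lt ha))
  have heK : Tendsto (fun i => e i / ⌊a ^ i⌋₊) atTop (𝓝 1) := by
    have hup : Tendsto (fun i : ℕ => 1 + (⌊a ^ i⌋₊ : ℝ)⁻¹) atTop (𝓝 1) := by
      simpa using hKtop.inv_tendsto_atTop.const_add 1
    refine tendsto_of_tendsto_of_tendsto_of_le_of_le tendsto_const_nhds hup (fun i => ?_)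
      fun i => ?_
    · exact (one_le_div (zero_lt_one.trans_le (hfl1 i))).2 (hN _)
    · have h0 := zero_lt_one.trans_le (hfl1 i)
      rw [div_le_iff₀ h0, add_mul, inv_mul_cancel₀ h0.ne', one_mul]
      exact hN' _
  filter_upwards [ae_tendsto_zero_of_summable_integral (fun i => (hMi i).div_const _)
      (fun i ω => by positivity) hsumM,
    ae_tendsto_zero_of_summable_integral (fun i => (hRi i).abs.div_const _)
      (fun i ω => div_nonneg (abs_nonneg _) (hepos i).le) hsumR] with ω h1 h2
  have h1' : Tendsto (fun i => M i ω / e i) atTop (𝓝 0) := by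
    have := h1.sqrt
    rw [Real.sqrt_zero] at this
    refine (tendsto_zero_iff_abs_tendsto_zero _).2 (this.congr fun i => ?_)
    rw [← div_pow, Real.sqrt_sq_eq_abs, Function.comp_apply]
  have h2' : Tendsto (fun i => R i ω / e i) atTop (𝓝 0) := by
    refine (tendsto_zero_iff_abs_tendsto_zero _).2 (h2.congr fun i => ?_)
    rw [Function.comp_apply, abs_div, abs_of_pos (hepos i)]
  have h3 := ((h1'.add h2').const_add 1).mul heK
  simp only [add_zero, mul_one] at h3
  refine h3.congr fun i => ?_
  have h0 := zero_lt_one.trans_le (hfl1 i)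
  rw [← add_div, ← hMR i ω, sub_div, div_self (hepos i).ne', add_sub_cancel,
    div_mul_div_cancel₀ (hepos i).ne']

theorem isStronglyBorelCantelli_of_summable {Ω E : Type*} [MeasurableSpace Ω]
    [MeasurableSpace E] [StandardBorelSpace E] [Nonempty E]
    {P : Measure Ω} [IsProbabilityMeasure P] {X : ℤ → Ω → E} (hX : ∀ i, Measurable (X i))
    (hstat : StrictlyStationary P X)
    {A : ℕ → Set E} (hA : ∀ k, 0 < k → MeasurableSet (A k)) (hdiv : DivergentMass (P.map (X 0)) A)
    (hsum : Summable fun j : ℕ => ((j + 1 : ℕ) : ℝ)⁻¹ * betaMixing P X (j + 1) *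
      quantileStar (P.map (X 0)) A (betaMixing P X (j + 1))) :
    IsStronglyBorelCantelli P fun k => X k ⁻¹' A k := by
  have : IsProbabilityMeasure (P.map (X 0)) := Measure.isProbabilityMeasure_map (hX 0).aemeasurable
  refine ⟨(divergentMass_preimage hX hstat hA).2 hdiv, ?_⟩
  have hE := divergentMass_iff_tendsto_hitMean.1 hdiv
  have hmean : ∀ n, hitMean P (fun k => X k ⁻¹' A k) n = hitMean (P.map (X 0)) A n := fun n =>
    Finset.sum_congr rfl fun k hk => by
      rw [← hstat.map_eq hX k, map_measureReal_apply (hX k) (hA k (Finset.mem_Icc.1 hk).1)]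
  simp_rw [hmean]
  set μ := P.map (X 0) with hμ
  have hex : ∀ K : ℕ, ∃ n, (K : ℝ) ≤ hitMean μ A n := fun K =>
    (hE.eventually_ge_atTop (K : ℝ)).exists
  classical
  set N : ℕ → ℕ := fun K => Nat.find (hex K) with hNdef
  have hN : ∀ K : ℕ, (K : ℝ) ≤ hitMean μ A (N K) := fun K => Nat.find_spec (hex K)
  have hlt : ∀ K n : ℕ, n < N K → hitMean μ A n < K := fun K n hn =>
    not_le.1 (Nat.find_min (hex K) hn)
  have hle : ∀ n K : ℕ, (K : ℝ) ≤ hitMean μ A n → N K ≤ n := fun n K hn => Nat.find_min' (hex K) hn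
  have hN' : ∀ K : ℕ, hitMean μ A (N K) ≤ K + 1 := by
    intro K
    rcases Nat.eq_zero_or_eq_succ_pred (N K) with h | h
    · rw [h]
      simp only [hitMean]
      simp
      positivity
    · rw [h, Nat.succ_eq_add_one, hitMean_succ]
      exact add_le_add (hlt K _ (by lia)).le measureReal_le_one
  have hNmono : Monotone N := fun K L hKL =>
    hle _ _ ((Nat.cast_le.2 hKL).trans (hN L))
  obtain ⟨q, hq, hqs⟩ := exists_dyadic_summable_comp
    (δ := fun p => betaMixing P X p * quantileStar μ A (betaMixing P X p))
    (fun p => mul_quantileStar_nonneg μ A (betaMixing_nonneg P X p))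
    (hsum.congr fun j => mul_assoc _ _ _)
  -- ratios `a > 1` with `a ^ (k + 1) = 4`
  set a : ℕ → ℝ := fun k => (4 : ℝ) ^ (((k + 1 : ℕ) : ℝ)⁻¹) with ha
  have ha1 : ∀ k, 1 < a k := fun k => Real.one_lt_rpow (by norm_num) (by positivity)
  have ham : ∀ k, a k ^ (k + 1) = 4 := fun k =>
    Real.rpow_inv_natCast_pow (by norm_num) k.succ_ne_zero
  have halim : Tendsto a atTop (𝓝 1) := by
    have h1 : Tendsto (fun k : ℕ => ((k + 1 : ℕ) : ℝ)⁻¹) atTop (𝓝 0) :=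
      (tendsto_inv_atTop_zero.comp tendsto_natCast_atTop_atTop).comp (tendsto_add_atTop_nat 1)
    have h2 := (Real.continuous_const_rpow (a := 4) (by norm_num)).tendsto 0
    rw [Real.rpow_zero] at h2
    exact h2.comp h1
  filter_upwards [ae_all_iff.2 fun k => ae_tendsto_hitCount_crossing hX hstat hA hN hN' hq hqs
    k.succ_pos (ha1 k) (ham k)] with ω hω
  refine tendsto_div_of_tendsto_crossing (hitCount_mono _ ω) (fun n => hitCount_nonneg _ n ω)
    hitMean_mono hE hN hle ?_
  exact tendsto_div_of_monotone_of_tendsto_div_floor_pow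
    (fun K => hitCount (fun k => X k ⁻¹' A k) (N K) ω) 1
    ((hitCount_mono _ ω).comp hNmono) a ha1 halim hω

/-! ### The three criteria -/

section Congr

variable {Ω : Type*} {B B' : ℕ → Set Ω}

theorem hitCount_congr (h : ∀ k, 0 < k → B k = B' k) : hitCount B = hitCount B' := by
  ext n ω
  exact Finset.sum_congr rfl fun k hk => by rw [h k (Finset.mem_Icc.1 hk).1]

variable [MeasurableSpace Ω] {P : Measure Ω}

theorem hitMean_congr (h : ∀ k, 0 < k → B k = B' k) : hitMean P B = hitMean P B' := by
  ext n
  exact Finset.sum_congr rfl fun k hk => by rw [h k (Finset.mem_Icc.1 hk).1]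

theorem divergentMass_congr (h : ∀ k, 0 < k → B k = B' k) :
    DivergentMass P B ↔ DivergentMass P B' := by
  simp only [DivergentMass, h _ (Nat.succ_pos _)]

theorem isBorelCantelli_congr (h : ∀ k, 0 < k → B k = B' k) :
    IsBorelCantelli P B ↔ IsBorelCantelli P B' := by
  rw [IsBorelCantelli, IsBorelCantelli, limsup_congr ((eventually_gt_atTop 0).mono h)]

theorem isL1BorelCantelli_congr (h : ∀ k, 0 < k → B k = B' k) :
    IsL1BorelCantelli P B ↔ IsL1BorelCantelli P B' := by
  rw [IsL1BorelCantelli, IsL1BorelCantelli, divergentMass_congr h, hitCount_congr h,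
    hitMean_congr h]

theorem isStronglyBorelCantelli_congr (h : ∀ k, 0 < k → B k = B' k) :
    IsStronglyBorelCantelli P B ↔ IsStronglyBorelCantelli P B' := by
  rw [IsStronglyBorelCantelli, IsStronglyBorelCantelli, divergentMass_congr h, hitCount_congr h,
    hitMean_congr h]

end Congr

theorem mainTheorem1
    {Ω E : Type*} [MeasurableSpace Ω]
    [TopologicalSpace E] [PolishSpace E] [MeasurableSpace E] [BorelSpace E] [Nonempty E]
    (P : Measure Ω) [IsProbabilityMeasure P]
    (X : ℤ → Ω → E) (hX : ∀ i, Measurable (X i))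
    (hstat : StrictlyStationary P X)
    (μ : Measure E) (hμ : μ = P.map (X 0))
    (hβ : Tendsto (fun n : ℕ => betaMixing P X n) atTop (𝓝 0))
    (A : ℕ → Set E) (hA : ∀ k, 0 < k → MeasurableSet (A k))
    (hdiv : DivergentMass μ A)
    (B : ℕ → Set Ω) (hB : ∀ k : ℕ, 0 < k → B k = {ω | X (k : ℤ) ω ∈ A k}) :
    (0 < μ (limsup A atTop) → IsBorelCantelli P B) ∧
    (UniformIntegrable (fun n : {n : ℕ // 0 < n} => normalizedHits μ A n) 1 μ →
      IsL1BorelCantelli P B) ∧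
    (Summable (fun j : ℕ =>
        ((j + 1 : ℕ) : ℝ)⁻¹ * betaMixing P X (j + 1) * quantileStar μ A (betaMixing P X (j + 1))) →
      IsStronglyBorelCantelli P B) := by
  subst hμ
  have hB' : ∀ k : ℕ, 0 < k → B k = X k ⁻¹' A k := hB
  refine ⟨fun hpos => ?_, fun hUI => ?_, fun hsum => ?_⟩
  · exact (isBorelCantelli_congr hB').2 (isBorelCantelli_of_limsup_pos hX hstat hβ hA hpos)
  · exact (isL1BorelCantelli_congr hB').2
      (isL1BorelCantelli_of_uniformIntegrable hX hstat hβ hA hdiv hUI)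
  · exact (isStronglyBorelCantelli_congr hB').2
      (isStronglyBorelCantelli_of_summable hX hstat hA hdiv hsum)
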